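/- **Definitions.** For a probability distribution $P$ on $\mathbb R$ with finite second moment let $\mu_P$ and $\sigma_P^2$ be its mean and variance. Let $n$ be a positive integer, $L>0$, $\delta_{\min}>0$ and let $\mathcal P$ be a class of such distributions. A *multiple-$\delta$ $L$-sub-Gaussian estimator* for $(\mathcal P,n,\delta_{\min})$ is a measurable map $\widehat E:\mathbb R^n\to\mathbb R$ such that for all $P\in\mathcal P$, all $\delta\in[\delta_{\min},1)$ and $X_1,\dots,X_n$ i.i.d. with law $P$, $$\Pr\Big\{|\widehat E(X_1^n)-\mu_P|>L\,\sigma_P\sqrt{\tfrac{1+\ln(1/\delta)}{n}}\Big\}\le\delta .$$ A *$\delta$-dependent $L$-sub-Gaussian estimator* for $(\mathcal P,n,\delta_{\min})$ is a measurable map $\widehat E:\mathbb R^n\times[\delta_{\min},1)\to\mathbb R$ satisfying the same bound with $\widehat E(X_1^n,\delta)$ in place of $\widehat E(X_1^n)$. For $\alpha\in(2,3]$ and $\eta\ge1$ let $$\mathcal P_{\alpha,\eta}=\{P:\ P \text{ has finite second moment and } \mathbb E_P|X-\mu_P|^\alpha\le(\eta\,\sigma_P)^\alpha\}.$$ *The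 $k$-regular estimator.* Let $n,k$ be positive integers with $n\ge(3+\ln4)\,124\,k$, and put $m=\lfloor\log_2(1/e^{3-n/(124k)})\rfloor-1\ge 1$. For $1\le j\le m$ let $b_j=\lceil 62\ln(3\cdot2^{j})\rceil$, partition $\{1,\dots,n\}$ into $b_j$ blocks with at least $\lfloor n/b_j\rfloor$ elements each, and let $y\in\mathbb R^{b_j}$ be the vector of the averages of the sample $x\in\mathbb R^n$ over these blocks. For $q\in(0,1)$ let the $q$-quantile of $y$ be $y_i$ for the smallest index $i$ with $\#\{l:y_l\le y_i\}\ge q\,b_j$ and $\#\{l:y_l\ge y_i\}\ge(1-q)\,b_j$. Let $I_j(x)$ be the closed interval from the $1/4$-quantile to the $3/4$-quantile of $y$, let $\hat k(x)$ be the least $k'\in\{1,\dots,m\}$ with $\bigcap_{j=k'}^m I_j(x)\neq\emptyset$, and let the $k$-regular estimator $\widehat E_{n,k}(x)$ be the midpoint of the interval $\bigcap_{j=\hat k(x)}^m I_j(x)$. Put $$\delta_{\min,n,k}=4e^{3-n/(124k)},\qquad L_*=4\sqrt{2(1+2\ln2)(1+62\ln3)}\;e^{5/2}.$$ **Theorem.**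 Let $\alpha\in(2,3]$. There is a constant $C_\alpha>0$, depending only on $\alpha$, such that for $\eta\ge3^{1/3}2^{1/6}$ and $k_\alpha=\lceil C_\alpha\,\eta^{2\alpha/(\alpha-2)}\rceil$ the following hold. 1. For all $\eta\ge3^{1/3}2^{1/6}$ and $n\ge(3+\ln4)\,124\,k_\alpha$, and for every choice of the block partitions, the $k$-regular estimator with $k=k_\alpha$ is a multiple-$\delta$ $L_*$-sub-Gaussian estimator for $(\mathcal P_{\alpha,\eta},n,\delta_{\min,n,k_\alpha})$. 2. For every $L\ge\sqrt2$ there are $n_{0,\alpha,L}\in\mathbb N$ and $c_{\alpha,L}>0$, depending only on $\alpha$ and $L$, such that for all $\eta\ge3^{1/3}2^{1/6}$ and all $n\ge n_{0,\alpha,L}\,k_\alpha$ there is no multiple-$\delta$ $L$-sub-Gaussian estimator for $(\mathcal P_{\alpha,\eta},n,e^{1-c_{\alpha,L}\,n/k_\alpha})$. 3. For all $\eta\ge3^{1/3}2^{1/6}$, $L\ge\sqrt2$ and $n\ge1$ there is no $\delta$-dependent $L$-sub-Gaussian estimator for $(\mathcal P_{\alpha,\eta},n,e^{1-5L^2n})$.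 -/

import Mathlib

open MeasureTheory ProbabilityTheory

noncomputable section

namespace SubGaussianMean

/-! Mean, standard deviation, and the two notions of sub-Gaussian estimator. -/

/-- The mean of a distribution on the real line. -/
def mean (P : ProbabilityMeasure ℝ) : ℝ := ∫ x, x ∂(P : Measure ℝ)

/-- The standard deviation of a distribution on the real line. -/
def stdDev (P : ProbabilityMeasure ℝ) : ℝ := √(variance id (P : Measure ℝ))

/-- The law of an i.i.d. sample of size `n` with distribution `P`. -/
def sampleLaw (P : ProbabilityMeasure ℝ) (n : ℕ) : Measure (Fin n → ℝ) :=
  Measure.pi fun _ => (P : Measure ℝ)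

/-- The sub-Gaussian deviation `L σ_P √((1 + ln (1/δ)) / n)`. -/
def deviation (L : ℝ) (P : ProbabilityMeasure ℝ) (n : ℕ) (δ : ℝ) : ℝ :=
  L * stdDev P * √((1 + Real.log (1 / δ)) / n)

/-- `E` is a multiple-`δ` `L`-sub-Gaussian estimator for `(Ps, n, δmin)`. -/
def IsMultipleDelta (L : ℝ) (Ps : Set (ProbabilityMeasure ℝ)) (n : ℕ) (δmin : ℝ)
    (E : (Fin n → ℝ) → ℝ) : Prop :=
  Measurable E ∧
    ∀ P ∈ Ps, ∀ δ ∈ Set.Ico δmin 1,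
      sampleLaw P n {x | deviation L P n δ < |E x - mean P|} ≤ ENNReal.ofReal δ

/-- `E` is a `δ`-dependent `L`-sub-Gaussian estimator for `(Ps, n, δmin)`: the confidence
parameter `δ ∈ [δmin, 1)` is an argument of the estimator. -/
def IsDeltaDependent (L : ℝ) (Ps : Set (ProbabilityMeasure ℝ)) (n : ℕ) (δmin : ℝ)
    (E : (Fin n → ℝ) × Set.Ico δmin 1 → ℝ) : Prop :=
  Measurable E ∧
    ∀ P ∈ Ps, ∀ δ : Set.Ico δmin 1,
      sampleLaw P n {x | deviation L P n δ < |E (x, δ) - mean P|} ≤ ENNReal.ofReal δ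

/-- Distributions with finite second moment whose `α`-th absolute central moment is finite and
at most `(η σ_P) ^ α`. -/
def momentClass (α η : ℝ) : Set (ProbabilityMeasure ℝ) :=
  {P | MemLp id 2 (P : Measure ℝ) ∧
    Integrable (fun x => |x - mean P| ^ α) (P : Measure ℝ) ∧
    ∫ x, |x - mean P| ^ α ∂(P : Measure ℝ) ≤ (η * stdDev P) ^ α}

/-! The estimator: quantiles of block means give confidence intervals, which are combined over
the confidence levels `2⁻¹, …, 2⁻ᵐ`. -/

/-- The two counting conditions that make `y i` a `q`-quantile of the vector `y`. -/
def IsQuantileIndex {b : ℕ} (q : ℝ) (y : Fin b → ℝ) (i : Fin b) : Prop :=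
  q * b ≤ ({j | y j ≤ y i} : Finset (Fin b)).card ∧
    (1 - q) * b ≤ ({l | y i ≤ y l} : Finset (Fin b)).card

open Classical in
/-- The `q`-quantile of `y`: the entry with the smallest index satisfying `IsQuantileIndex`
(such an index exists if `0 < q < 1` and `0 < b`). -/
def quantile {b : ℕ} (q : ℝ) (y : Fin b → ℝ) : ℝ :=
  if h : ∃ i, IsQuantileIndex q y i then y (Fin.find _ h) else 0

/-- The number of blocks at confidence level `δ`. -/
def blockCount (δ : ℝ) : ℕ := ⌈62 * Real.log (3 / δ)⌉₊

/-- The vector of block means; the block with label `a` is the fibre of `B` over `a`. -/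
def blockMean {n b : ℕ} (B : Fin n → Fin b) (x : Fin n → ℝ) (a : Fin b) : ℝ :=
  (∑ i with B i = a, x i) / ({i | B i = a} : Finset (Fin n)).card

/-- A choice, for each `j`, of a partition of the sample into as many blocks as the confidence
level `2⁻ʲ` requires. -/
abbrev Blocks (n : ℕ) : Type := ∀ j : ℕ, Fin n → Fin (blockCount ((1 / 2) ^ j))

/-- With `b` blocks for a sample of size `n`, each block has at least `⌊n / b⌋` elements. -/
def Blocks.Balanced {n : ℕ} (B : Blocks n) : Prop :=
  ∀ j a, n / blockCount ((1 / 2) ^ j) ≤ ({i | B j i = a} : Finset (Fin n)).card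

/-- The confidence interval at level `2⁻ʲ`: from the `1/4`- to the `3/4`-quantile of the block
means. -/
def confInterval {n : ℕ} (B : Blocks n) (x : Fin n → ℝ) (j : ℕ) : Set ℝ :=
  Set.Icc (quantile (1 / 4) (blockMean (B j) x)) (quantile (3 / 4) (blockMean (B j) x))

/-- The number `m` of confidence levels used with sample size `n` and regularity parameter `k`:
`⌊log₂ (1 / e ^ (3 - n / (124 k)))⌋ - 1`. -/
def levels (n k : ℕ) : ℕ := ⌊Real.logb 2 (1 / Real.exp (3 - n / (124 * k)))⌋₊ - 1

/-- The intersection of the confidence intervals with indices `k', …, m`. -/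
def tailInter {n : ℕ} (B : Blocks n) (m : ℕ) (x : Fin n → ℝ) (k' : ℕ) : Set ℝ :=
  {t | ∀ j ∈ Finset.Icc k' m, t ∈ confInterval B x j}

/-- The least index `k' ∈ {1, …, m}` for which the intersection of the intervals with indices
`k', …, m` is not empty. -/
def firstIndex {n : ℕ} (B : Blocks n) (m : ℕ) (x : Fin n → ℝ) : ℕ :=
  sInf {k' | k' ∈ Finset.Icc 1 m ∧ (tailInter B m x k').Nonempty}

/-- The estimator for `k`-regular distributions: the midpoint of the interval
`⋂ j ∈ {k̂, …, m}, I_j`, with `k̂` given by `firstIndex`. -/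
def regularEstimator {n : ℕ} (k : ℕ) (B : Blocks n) (x : Fin n → ℝ) : ℝ :=
  let S := tailInter B (levels n k) x (firstIndex B (levels n k) x)
  (sInf S + sSup S) / 2

/-- The constant `L_*`. -/
def LStar : ℝ :=
  4 * √(2 * (1 + 2 * Real.log 2) * (1 + 62 * Real.log 3)) * Real.exp (5 / 2)

/-- The smallest confidence parameter `4 e ^ (3 - n / (124 k))`. -/
def deltaMin (n k : ℕ) : ℝ := 4 * Real.exp (3 - n / (124 * k))

/-- The integer `k_α = ⌈C η ^ (2 α / (α - 2))⌉`. -/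
def kAlpha (C α η : ℝ) : ℕ := ⌈C * η ^ (2 * α / (α - 2))⌉₊

theorem blockCount_pos (j : ℕ) : 0 < blockCount ((1 / 2) ^ j) := by
  have h : (1 / 2 : ℝ) ^ j ≤ 1 := pow_le_one₀ (by norm_num) (by norm_num)
  have h0 : (0 : ℝ) < (1 / 2) ^ j := by positivity
  have h1 : 1 < 3 / (1 / 2 : ℝ) ^ j := by
    rw [lt_div_iff₀ h0]; linarith
  exact Nat.ceil_pos.2 (mul_pos (by norm_num) (Real.log_pos h1))

/-- Balanced choices of blocks exist: take residue classes. -/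
theorem exists_balanced (n : ℕ) : ∃ B : Blocks n, B.Balanced := by
  refine ⟨fun j i => ⟨i % blockCount ((1 / 2) ^ j), Nat.mod_lt _ (blockCount_pos j)⟩, ?_⟩
  intro j
  have hb0 := blockCount_pos j
  change ∀ a : Fin (blockCount ((1 / 2) ^ j)), n / blockCount ((1 / 2) ^ j) ≤
    ({i | (⟨i % blockCount ((1 / 2) ^ j), Nat.mod_lt _ hb0⟩ :
      Fin (blockCount ((1 / 2) ^ j))) = a} : Finset (Fin n)).card
  generalize blockCount ((1 / 2) ^ j) = b at hb0 ⊢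
  intro a
  have hlt : ∀ t : Fin (n / b), b * t + a < n := by
    intro t
    have h1 : b * (t + 1) ≤ b * (n / b) := Nat.mul_le_mul_left _ t.2
    have h2 : b * (n / b) ≤ n := Nat.mul_div_le n b
    have h3 := a.2
    rw [mul_add, mul_one] at h1
    omega
  rw [← Fintype.card_fin (n / b), ← Finset.card_univ]
  refine Finset.card_le_card_of_injOn (fun t => ⟨b * t + a, hlt t⟩) ?_ ?_
  · intro t _
    simp only [Finset.coe_filter, Finset.mem_univ, true_and, Set.mem_ofPred_eq]
    apply Fin.ext
    change (b * (t : ℕ) + a) % b = a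
    rw [Nat.mul_add_mod]
    exact Nat.mod_eq_of_lt a.2
  · intro s _ t _ hst
    have h := congrArg Fin.val hst
    simp only [Nat.add_right_cancel_iff] at h
    exact Fin.ext (Nat.eq_of_mul_eq_mul_left hb0 h)

end SubGaussianMean

end

open SubGaussianMean

/-!
The three parts rest on two ideas.

*Upper bound.* If sums of at least `k` independent copies of `P` fall on either side of their mean
with probability close to `1 / 2`, then in each of the `b` blocks of level `2⁻ʲ` the block mean
exceeds `μ_P` with probability at most `3 / 5`, so by Chernoff's bound for independent blocks more
than a quarter of the block means lie on each side of `μ_P`, up to probability `2 / 3 * 2⁻ʲ`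
(`sampleLaw_mean_notMem_le`). By Chebyshev's inequality a given block mean is far from `μ_P` with a
tiny probability, so less than a quarter of them are far and the interval `I_j` is short
(`sampleLaw_confInterval_not_subset_le`). If `μ_P` lies in all of `I_j, …, I_m`, then the estimator
lies in `I_j` too (`regularEstimator_mem_confInterval`), and a union bound over the levels `j, …, m`
with `2⁻ʲ` comparable to `δ` gives `isMultipleDelta_regularEstimator`. That `k_α` terms suffice for
the laws in `momentClass α η` is a one-sided central limit theorem with an error bound
(`exists_sampleLaw_sum_pos_le`). It follows from Lindeberg's replacement of the summands by Gaussian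
ones inside a smoothed indicator function: Taylor's formula bounds each replacement by absolute
moments of order `α`, and since the constant `C` is free, the rate in `k` is all that matters.

*Lower bounds.* Both use Le Cam's two-point argument (`two_point_le`). An estimator that is
accurate under `P₁` errs under `P₀` whenever a `P₀`-sample looks like a `P₁`-sample, and the
likelihood ratio bounds the probability of that from below. A bound on the kurtosis puts a law into
`momentClass α η` (`mem_momentClass_of_kurtosis_le`).

For multiple-`δ` estimators, `P₀` and `P₁` are Poisson laws with parameters `r ≍ 1 / k_α` and `u r`.
The confusion has probability at least `exp (-O(u log u) n r)`, whereas a sub-Gaussian tail at the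
distance `(u - 1) r` of the means is `exp (-Ω(u² / L²) n r)`; a large `u` makes the two incompatible
(`exists_not_isMultipleDelta`).

For `δ`-dependent estimators, with `y = 5 L²`, the law `P₀` is a random sign contaminated by
clusters at `±y` of weight `8 / y⁴`, which keeps the kurtosis below `18`, and `P₁` is the cluster at
`y`. The allowed deviations `L √y σ` of the two laws add up to less than `y`, but all observations
fall into the cluster with probability `(8 / y⁴) ^ n`, much more than `exp (1 - y n)`
(`not_isDeltaDependent`).
-/

namespace SubGaussianMean

/-! ### Smoothed indicator functions and Taylor's formula -/

theorem abs_le_pow_succ_of_deriv_le {g g' : ℝ → ℝ} {K : ℝ} {j : ℕ} (h0 : g 0 = 0)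
    (hg : ∀ t, HasDerivAt g (g' t) t) (hb : ∀ t, |g' t| ≤ K * |t| ^ j) (t : ℝ) :
    |g t| ≤ K * |t| ^ (j + 1) := by
  have hK : 0 ≤ K := by simpa using (abs_nonneg _).trans (hb 1)
  have := (convex_Icc (-|t|) |t|).norm_image_sub_le_of_norm_hasDerivWithin_le
    (f := g) (f' := g') (C := K * |t| ^ j) (x := 0) (y := t)
    (fun s _ => (hg s).hasDerivWithinAt)
    (fun s hs => (hb s).trans (mul_le_mul_of_nonneg_left
      (pow_le_pow_left₀ (abs_nonneg s) (abs_le.2 hs) j) hK))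
    ⟨by simp, abs_nonneg t⟩ ⟨neg_abs_le t, le_abs_self t⟩
  simpa [h0, pow_succ, mul_assoc] using this

theorem abs_taylor_two_le {f f₁ f₂ f₃ : ℝ → ℝ} {M α : ℝ} (hα : 2 ≤ α ∧ α ≤ 3)
    (h₁ : ∀ x, HasDerivAt f (f₁ x) x) (h₂ : ∀ x, HasDerivAt f₁ (f₂ x) x)
    (h₃ : ∀ x, HasDerivAt f₂ (f₃ x) x) (hM₂ : ∀ x, |f₂ x| ≤ M) (hM₃ : ∀ x, |f₃ x| ≤ M)
    (x h : ℝ) :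
    |f (x + h) - (f x + f₁ x * h + f₂ x / 2 * h ^ 2)| ≤ 2 * M * |h| ^ α := by
  have hM : 0 ≤ M := (abs_nonneg _).trans (hM₂ 0)
  set R : ℝ → ℝ := fun t => f (x + t) - (f x + f₁ x * t + f₂ x / 2 * t ^ 2) with hR
  set R₁ : ℝ → ℝ := fun t => f₁ (x + t) - (f₁ x + f₂ x * t) with hR₁
  set R₂ : ℝ → ℝ := fun t => f₂ (x + t) - f₂ x with hR₂
  have d₁ : ∀ t, HasDerivAt R (R₁ t) t := by
    intro t
    have a := (h₁ (x + t)).comp_const_add x t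
    have b := (((hasDerivAt_id t).const_mul (f₁ x)).const_add (f x)).add
      (((hasDerivAt_id t).pow 2).const_mul (f₂ x / 2))
    refine (a.sub b).congr_deriv ?_
    simp only [hR₁, id]
    push_cast
    ring
  have d₂ : ∀ t, HasDerivAt R₁ (R₂ t) t := by
    intro t
    have a := (h₂ (x + t)).comp_const_add x t
    have b := ((hasDerivAt_id t).const_mul (f₂ x)).const_add (f₁ x)
    refine (a.sub b).congr_deriv ?_
    simp [hR₂]
  have d₃ : ∀ t, HasDerivAt R₂ (f₃ (x + t)) t := fun t =>
    ((h₃ (x + t)).comp_const_add x t).sub_const _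
  have z : R 0 = 0 := by simp [hR]
  have z₁ : R₁ 0 = 0 := by simp [hR₁]
  have z₂ : R₂ 0 = 0 := by simp [hR₂]
  have key : |R h| ≤ 2 * M * |h| ^ 2 ∧ |R h| ≤ M * |h| ^ 3 := by
    constructor
    · have e₂ : ∀ t, |R₂ t| ≤ 2 * M * |t| ^ 0 := fun t => by
        have := abs_sub (f₂ (x + t)) (f₂ x)
        simp only [hR₂, pow_zero, mul_one]
        linarith [hM₂ x, hM₂ (x + t)]
      exact abs_le_pow_succ_of_deriv_le z d₁ (abs_le_pow_succ_of_deriv_le z₁ d₂ e₂) h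
    · have e₃ : ∀ t, |f₃ (x + t)| ≤ M * |t| ^ 0 := fun t => by simpa using hM₃ (x + t)
      exact abs_le_pow_succ_of_deriv_le z d₁ (abs_le_pow_succ_of_deriv_le z₁ d₂
        (abs_le_pow_succ_of_deriv_le z₂ d₃ e₃)) h
  change |R h| ≤ _
  rcases le_total |h| 1 with h1 | h1
  · rcases eq_or_ne h 0 with rfl | h0
    · rw [z, abs_zero]; positivity
    have : |h| ^ (3 : ℕ) ≤ |h| ^ α := by
      rw [← Real.rpow_natCast]
      exact Real.rpow_le_rpow_of_exponent_ge (abs_pos.2 h0) h1 (by exact_mod_cast hα.2)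
    refine key.2.trans ?_
    have h3 : 0 ≤ |h| ^ (3 : ℕ) := by positivity
    nlinarith
  · have : |h| ^ (2 : ℕ) ≤ |h| ^ α := by
      rw [← Real.rpow_natCast]
      exact Real.rpow_le_rpow_of_exponent_le h1 (by exact_mod_cast hα.1)
    exact key.1.trans (by gcongr)

/-- A smooth function that lies between the indicators of `[0, ∞)` and `[-ε, ∞)`, together with
its first three derivatives, bounded. -/
theorem exists_smooth_step {ε : ℝ} (hε : 0 < ε) : ∃ f f₁ f₂ f₃ : ℝ → ℝ, ∃ M : ℝ,
    (∀ x, HasDerivAt f (f₁ x) x) ∧ (∀ x, HasDerivAt f₁ (f₂ x) x) ∧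
    (∀ x, HasDerivAt f₂ (f₃ x) x) ∧ (∀ x, |f₂ x| ≤ M) ∧ (∀ x, |f₃ x| ≤ M) ∧
    (∀ x, 0 ≤ f x) ∧ (∀ x, f x ≤ 1) ∧ (∀ x, 0 ≤ x → f x = 1) ∧ (∀ x, x ≤ -ε → f x = 0) := by
  set f : ℝ → ℝ := fun x => Real.smoothTransition (1 + x / ε) with hf
  have hc : ContDiff ℝ 3 f := (Real.smoothTransition.contDiff (n := 3)).comp (by fun_prop)
  have hd : ∀ m : ℕ, m < 3 → ∀ x, HasDerivAt (deriv^[m] f) (deriv^[m + 1] f x) x := by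
    intro m hm x
    have := hc.differentiable_iteratedDeriv m (by exact_mod_cast hm)
    rw [iteratedDeriv_eq_iterate] at this
    have h2 := (this x).hasDerivAt
    rwa [Function.iterate_succ_apply']
  have hsupp : ∀ m : ℕ, m < 3 → ∀ x, x ∉ Set.Icc (-ε) 0 → deriv^[m + 1] f x = 0 := by
    intro m hm x hx
    rw [← iteratedDeriv_eq_iterate]
    rw [Set.mem_Icc, not_and_or, not_le, not_le] at hx
    rcases hx with hx | hx
    · have : f =ᶠ[nhds x] fun _ => 0 := by
        filter_upwards [Iio_mem_nhds hx] with y hy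
        apply Real.smoothTransition.zero_of_nonpos
        have : y / ε < -1 := by rw [div_lt_iff₀ hε]; linarith [Set.mem_Iio.1 hy]
        linarith
      rw [this.iteratedDeriv_eq (n := m + 1), iteratedDeriv_const]
      simp
    · have : f =ᶠ[nhds x] fun _ => 1 := by
        filter_upwards [Ioi_mem_nhds hx] with y hy
        apply Real.smoothTransition.one_of_one_le
        have : 0 < y / ε := div_pos hy hε
        linarith
      rw [this.iteratedDeriv_eq (n := m + 1), iteratedDeriv_const]
      simp
  have hbd : ∀ m : ℕ, m < 3 → ∃ M, ∀ x, |deriv^[m + 1] f x| ≤ M := by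
    intro m hm
    have hcont : Continuous (deriv^[m + 1] f) := by
      have := hc.continuous_iteratedDeriv (m + 1) (by exact_mod_cast hm)
      rwa [iteratedDeriv_eq_iterate] at this
    obtain ⟨M, hM⟩ := (isCompact_Icc (a := -ε) (b := 0)).exists_bound_of_continuousOn
      hcont.continuousOn
    refine ⟨M, fun x => ?_⟩
    by_cases hx : x ∈ Set.Icc (-ε) 0
    · exact hM x hx
    · rw [hsupp m hm x hx, abs_zero]
      exact (norm_nonneg _).trans (hM 0 ⟨by linarith, le_rfl⟩)
  obtain ⟨M₂, hM₂⟩ := hbd 1 (by norm_num)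
  obtain ⟨M₃, hM₃⟩ := hbd 2 (by norm_num)
  refine ⟨f, deriv^[1] f, deriv^[2] f, deriv^[3] f, max M₂ M₃, hd 0 (by norm_num),
    hd 1 (by norm_num), hd 2 (by norm_num), fun x => (hM₂ x).trans (le_max_left _ _),
    fun x => (hM₃ x).trans (le_max_right _ _), fun x => Real.smoothTransition.nonneg _,
    fun x => Real.smoothTransition.le_one _, fun x hx => ?_, fun x hx => ?_⟩
  · apply Real.smoothTransition.one_of_one_le
    have : 0 ≤ x / ε := div_nonneg hx hε.le
    linarith
  · apply Real.smoothTransition.zero_of_nonpos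
    have : x / ε ≤ -1 := by rw [div_le_iff₀ hε]; linarith
    linarith

/-! ### Lindeberg's replacement argument -/

section Lindeberg

open Measure

/-- The law of the sum of `s` independent variables with law `P`. -/
noncomputable def convPow (P : Measure ℝ) : ℕ → Measure ℝ
  | 0 => dirac 0
  | s + 1 => P ∗ convPow P s

instance convPow.instIsProbabilityMeasure (P : Measure ℝ) [IsProbabilityMeasure P] (s : ℕ) :
    IsProbabilityMeasure (convPow P s) := by
  induction s with
  | zero => rw [convPow]; infer_instance
  | succ s ih => rw [convPow]; infer_instance

theorem convPow_gaussianReal (v : NNReal) (s : ℕ) :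
    convPow (gaussianReal 0 v) s = gaussianReal 0 (s * v) := by
  induction s with
  | zero => simp [convPow]
  | succ s ih =>
    rw [convPow, ih, gaussianReal_conv_gaussianReal]
    congr 1
    · simp
    · push_cast; ring

theorem map_sum_pi_eq_convPow {n : ℕ} (P : Measure ℝ) [IsProbabilityMeasure P] {g : ℝ → ℝ}
    (hg : Measurable g) (F : Finset (Fin n)) :
    (Measure.pi fun _ : Fin n => P).map (fun x => ∑ i ∈ F, g (x i)) = convPow (P.map g) F.card := by
  induction F using Finset.induction_on with
  | empty => simp [convPow]
  | insert a F ha ih =>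
    have hm : ∀ i : Fin n, Measurable fun x : Fin n → ℝ => g (x i) := fun i => by fun_prop
    have hind : iIndepFun (fun (i : Fin n) (x : Fin n → ℝ) => g (x i))
        (Measure.pi fun _ : Fin n => P) :=
      iIndepFun_pi (X := fun _ => g) fun _ => hg.aemeasurable
    have h2 := (hind.indepFun_finsetSum_of_notMem hm ha).symm
    have h1 : (Measure.pi fun _ : Fin n => P).map (fun x => g (x a)) = P.map g := by
      have := (measurePreserving_eval (fun _ : Fin n => P) a).map_eq
      conv_rhs => rw [← this]
      rw [Measure.map_map hg (measurable_pi_apply a)]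
      rfl
    rw [Finset.card_insert_of_notMem ha, convPow, ← ih, ← h1]
    rw [show (fun x : Fin n → ℝ => ∑ i ∈ F, g (x i)) = ∑ i ∈ F, fun x : Fin n → ℝ => g (x i) by
      ext; simp]
    rw [← h2.map_add_eq_map_conv_map (hm a) (by fun_prop)]
    congr 1
    ext x
    simp [Finset.sum_insert ha]

/-- Integrating the second order Taylor expansion at `x` against a centred law of variance `v`. -/
theorem abs_integral_add_sub_le {f : ℝ → ℝ} {P : Measure ℝ} [IsProbabilityMeasure P]
    {A B x v K α : ℝ} (hf : Integrable (fun h => f (x + h)) P)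
    (hT : ∀ h, |f (x + h) - (f x + A * h + B * h ^ 2)| ≤ K * |h| ^ α)
    (h2 : MemLp id 2 P) (hm : ∫ h, h ∂P = 0) (hv : ∫ h, h ^ 2 ∂P = v)
    (hα : Integrable (fun h => |h| ^ α) P) :
    |∫ h, f (x + h) ∂P - (f x + B * v)| ≤ K * ∫ h, |h| ^ α ∂P := by
  have i1 : Integrable (fun h : ℝ => h) P := h2.integrable one_le_two
  have i2 : Integrable (fun h : ℝ => h ^ 2) P := h2.integrable_sq
  have i3 : Integrable (fun h : ℝ => f x + A * h) P := (integrable_const _).add (i1.const_mul A)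
  have e : ∫ h, (f x + A * h + B * h ^ 2) ∂P = f x + B * v := by
    rw [integral_add i3 (i2.const_mul B), integral_add (integrable_const _) (i1.const_mul A),
      integral_const_mul, integral_const_mul, hm, hv]
    simp
  have i4 : Integrable (fun h => f x + A * h + B * h ^ 2) P := i3.add (i2.const_mul B)
  rw [← e, ← integral_sub hf i4, ← integral_const_mul]
  exact (abs_integral_le_integral_abs).trans
    (integral_mono_of_nonneg (ae_of_all _ fun _ => abs_nonneg _) (hα.const_mul K) (ae_of_all _ hT))

/-- Two laws with the same first two moments are interchangeable, up to the absolute moments of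
order `α`, in front of a smooth function. -/
theorem abs_integral_conv_sub_le {f f₁ f₂ f₃ : ℝ → ℝ} {M α v : ℝ} (hα : 2 ≤ α ∧ α ≤ 3)
    (h₁ : ∀ x, HasDerivAt f (f₁ x) x) (h₂ : ∀ x, HasDerivAt f₁ (f₂ x) x)
    (h₃ : ∀ x, HasDerivAt f₂ (f₃ x) x) (hM₂ : ∀ x, |f₂ x| ≤ M) (hM₃ : ∀ x, |f₃ x| ≤ M)
    (hb : ∀ x, |f x| ≤ 1) (P G R : Measure ℝ) [IsProbabilityMeasure P] [IsProbabilityMeasure G]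
    [IsProbabilityMeasure R] (hP : MemLp id 2 P) (hP1 : ∫ h, h ∂P = 0) (hP2 : ∫ h, h ^ 2 ∂P = v)
    (hPα : Integrable (fun h => |h| ^ α) P) (hG : MemLp id 2 G) (hG1 : ∫ h, h ∂G = 0)
    (hG2 : ∫ h, h ^ 2 ∂G = v) (hGα : Integrable (fun h => |h| ^ α) G) :
    |∫ x, f x ∂(R ∗ P) - ∫ x, f x ∂(R ∗ G)| ≤
      2 * M * ∫ h, |h| ^ α ∂P + 2 * M * ∫ h, |h| ^ α ∂G := by
  have hfm : Measurable f := (continuous_iff_continuousAt.2 fun x => (h₁ x).continuousAt).measurable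
  have hfi : ∀ (Q : Measure ℝ) [IsProbabilityMeasure Q] (x : ℝ),
      Integrable (fun h => f (x + h)) Q := fun Q _ x =>
    Integrable.of_bound (C := 1) (hfm.comp (by fun_prop)).aestronglyMeasurable
      (ae_of_all _ fun _ => hb _)
  have hfi0 : ∀ (Q : Measure ℝ) [IsProbabilityMeasure Q], Integrable f Q := fun Q _ =>
    Integrable.of_bound (C := 1) hfm.aestronglyMeasurable (ae_of_all _ fun _ => hb _)
  have hprod : ∀ (Q : Measure ℝ) [IsProbabilityMeasure Q],
      Integrable (fun p : ℝ × ℝ => f (p.1 + p.2)) (R.prod Q) := fun Q _ =>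
    Integrable.of_bound (C := 1) (hfm.comp (by fun_prop)).aestronglyMeasurable
      (ae_of_all _ fun _ => hb _)
  rw [integral_conv (hfi0 _), integral_conv (hfi0 _),
    ← integral_sub (hprod P).integral_prod_left (hprod G).integral_prod_left]
  have hbd : ∀ x, ‖∫ y, f (x + y) ∂P - ∫ y, f (x + y) ∂G‖ ≤
      2 * M * ∫ h, |h| ^ α ∂P + 2 * M * ∫ h, |h| ^ α ∂G := fun x => ?_
  · simpa using norm_integral_le_of_norm_le_const (μ := R) (ae_of_all _ hbd)
  have hT := abs_taylor_two_le hα h₁ h₂ h₃ hM₂ hM₃ x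
  have a := abs_integral_add_sub_le (hfi P x) hT hP hP1 hP2 hPα
  have b := abs_integral_add_sub_le (hfi G x) hT hG hG1 hG2 hGα
  rw [Real.norm_eq_abs]
  rw [abs_sub_comm] at b
  exact (abs_sub_le _ _ _).trans (add_le_add a b)

/-- Lindeberg's replacement argument: `P` is replaced by `G` in one factor of the convolution power
at a time. -/
theorem abs_integral_convPow_sub_le {f : ℝ → ℝ} {K : ℝ} (P G : Measure ℝ)
    [IsProbabilityMeasure P] [IsProbabilityMeasure G]
    (hswap : ∀ (R : Measure ℝ) [IsProbabilityMeasure R],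
      |∫ x, f x ∂(R ∗ P) - ∫ x, f x ∂(R ∗ G)| ≤ K) (s : ℕ) :
    |∫ x, f x ∂(convPow P s) - ∫ x, f x ∂(convPow G s)| ≤ s * K := by
  have key : ∀ (s : ℕ) (R : Measure ℝ) [IsProbabilityMeasure R],
      |∫ x, f x ∂(R ∗ convPow P s) - ∫ x, f x ∂(R ∗ convPow G s)| ≤ s * K := by
    intro s
    induction s with
    | zero => intro R _; simp [convPow]
    | succ s ih =>
      intro R _
      rw [convPow, convPow, ← conv_assoc, ← conv_assoc]
      have a := ih (R ∗ P)
      have b := hswap (R ∗ convPow G s)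
      have e : ∀ Q : Measure ℝ, [IsProbabilityMeasure Q] →
          (R ∗ convPow G s) ∗ Q = (R ∗ Q) ∗ convPow G s := fun Q _ => by
        rw [conv_assoc, conv_comm (convPow G s), conv_assoc]
      rw [e, e] at b
      refine (abs_sub_le _ _ _).trans ((add_le_add a b).trans ?_)
      push_cast
      linarith
  simpa using key s (dirac 0)

theorem gaussianReal_Ioi_neg_le {ε : ℝ} (hε : 0 ≤ ε) :
    (gaussianReal 0 1).real (Set.Ioi (-ε)) ≤ 1 / 2 + ε := by
  have h1 : (gaussianReal 0 1).real (Set.Ioi 0) ≤ 1 / 2 := by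
    have e : (gaussianReal 0 1).real (Set.Iio 0) = (gaussianReal 0 1).real (Set.Ioi 0) := by
      have := gaussianReal_map_neg (μ := 0) (v := 1)
      rw [neg_zero] at this
      conv_lhs => rw [← this]
      rw [map_measureReal_apply measurable_neg measurableSet_Iio]
      congr 1
      ext; simp
    have := measureReal_union (μ := gaussianReal 0 1) (s₁ := Set.Iio (0 : ℝ)) (s₂ := Set.Ioi 0)
      (Set.disjoint_left.2 fun x hx hy => lt_asymm (Set.mem_Iio.1 hx) (Set.mem_Ioi.1 hy)) measurableSet_Ioi
    have h2 := measureReal_le_one (μ := gaussianReal 0 1) (s := Set.Iio (0 : ℝ) ∪ Set.Ioi 0)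
    linarith
  have h2 : (gaussianReal 0 1).real (Set.Ioc (-ε) 0) ≤ ε := by
    rw [measureReal_def, gaussianReal_apply_eq_integral _ one_ne_zero,
      ENNReal.toReal_ofReal (integral_nonneg fun x => gaussianPDFReal_nonneg _ _ _)]
    have hb : ∀ x, gaussianPDFReal 0 1 x ≤ 1 := by
      intro x
      rw [gaussianPDFReal]
      have : 1 ≤ √(2 * Real.pi * (1 : NNReal)) := by
        rw [Real.one_le_sqrt]
        have := Real.pi_gt_three
        norm_num
        linarith
      exact mul_le_one₀ (inv_le_one_of_one_le₀ this) (Real.exp_pos _).le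
        (Real.exp_le_one_iff.2 (div_nonpos_of_nonpos_of_nonneg (neg_nonpos.2 (sq_nonneg _))
          (by positivity)))
    have := setIntegral_mono_on (μ := volume) (s := Set.Ioc (-ε) 0)
      (integrable_gaussianPDFReal 0 1).integrableOn
      (g := fun _ => (1 : ℝ)) (by simp) measurableSet_Ioc (fun x _ => hb x)
    refine this.trans ?_
    simp [hε]
  have h3 : Set.Ioi (-ε) = Set.Ioc (-ε) 0 ∪ Set.Ioi 0 := (Set.Ioc_union_Ioi_eq_Ioi (by linarith)).symm
  rw [h3]
  exact (measureReal_union_le _ _).trans (by linarith)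

theorem integrable_abs_rpow_gaussianReal {α : ℝ} (hα : 0 < α) :
    Integrable (fun x => |x| ^ α) (gaussianReal 0 1) := by
  have := (memLp_id_gaussianReal (μ := 0) (v := 1) α.toNNReal).integrable_norm_rpow
    (by simpa using hα) (by simp)
  simpa [hα.le] using this

/-- A one-sided quantitative central limit theorem for sums of `s` centred variables of variance
`1 / s`. -/
theorem exists_convPow_Ioi_le {α : ℝ} (hα : 2 ≤ α ∧ α ≤ 3) : ∃ D : ℝ, 0 ≤ D ∧
    ∀ (Q : Measure ℝ) [IsProbabilityMeasure Q] (s : ℕ), 0 < s → MemLp id 2 Q → ∫ x, x ∂Q = 0 →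
      ∫ x, x ^ 2 ∂Q = (s : ℝ)⁻¹ → Integrable (fun x => |x| ^ α) Q →
      (convPow Q s).real (Set.Ioi 0) ≤
        11 / 20 + s * (D * (∫ x, |x| ^ α ∂Q + (√s)⁻¹ ^ α)) := by
  obtain ⟨f, f₁, f₂, f₃, M, h₁, h₂, h₃, hM₂, hM₃, hf0, hf1, hfpos, hfneg⟩ :=
    exists_smooth_step (ε := 1 / 20) (by norm_num)
  have hM : 0 ≤ M := (abs_nonneg _).trans (hM₂ 0)
  set K := ∫ x, |x| ^ α ∂(gaussianReal 0 1) with hK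
  have hK0 : 0 ≤ K := integral_nonneg fun x => by positivity
  have hfm : Measurable f := (continuous_iff_continuousAt.2 fun x => (h₁ x).continuousAt).measurable
  have hb : ∀ x, |f x| ≤ 1 := fun x => abs_le.2 ⟨by linarith [hf0 x], hf1 x⟩
  have hfi0 : ∀ (Q : Measure ℝ) [IsProbabilityMeasure Q], Integrable f Q := fun Q _ =>
    Integrable.of_bound (C := 1) hfm.aestronglyMeasurable (ae_of_all _ fun _ => hb _)
  refine ⟨2 * M * (1 + K), by positivity, fun Q _ s hs h2 hm hv hαQ => ?_⟩
  have hs' : (0 : ℝ) < s := by exact_mod_cast hs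
  have hsq : 0 < √(s : ℝ) := Real.sqrt_pos.2 hs'
  have hα0 : 0 ≤ α := by linarith [hα.1]
  -- the Gaussian law of variance `1 / s`
  set G := gaussianReal 0 (s : NNReal)⁻¹ with hG
  have hGmap : G = (gaussianReal 0 1).map ((√(s : ℝ))⁻¹ * ·) := by
    rw [gaussianReal_map_const_mul, hG]
    congr 1
    · simp
    · ext
      simp [inv_pow, Real.sq_sqrt hs'.le]
  have hGα : ∫ x, |x| ^ α ∂G = (√(s : ℝ))⁻¹ ^ α * K := by
    rw [hGmap, integral_map (by fun_prop) (by fun_prop (disch := exact hα0)), hK, ← integral_const_mul]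
    congr 1
    ext x
    rw [abs_mul, Real.mul_rpow (abs_nonneg _) (abs_nonneg _), abs_of_nonneg (inv_nonneg.2 hsq.le)]
  have hGαi : Integrable (fun x => |x| ^ α) G := by
    rw [hGmap, integrable_map_measure (by fun_prop (disch := exact hα0)) (by fun_prop)]
    refine ((integrable_abs_rpow_gaussianReal (α := α) (by linarith [hα.1])).const_mul
      ((√(s : ℝ))⁻¹ ^ α)).congr (ae_of_all _ fun x => ?_)
    simp only [Function.comp]
    rw [abs_mul, Real.mul_rpow (abs_nonneg _) (abs_nonneg _), abs_of_nonneg (inv_nonneg.2 hsq.le)]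
  have hG1 : ∫ x, x ∂G = 0 := integral_id_gaussianReal
  have hG2 : ∫ x, x ^ 2 ∂G = (s : ℝ)⁻¹ := by
    have := variance_eq_integral (μ := G) (X := id) measurable_id.aemeasurable
    simp only [id, hG1, sub_zero] at this
    rw [← this]
    exact (variance_id_gaussianReal (μ := 0) (v := (s : NNReal)⁻¹)).trans (by simp)
  have hswap := abs_integral_convPow_sub_le (f := f) Q G (fun R _ =>
    abs_integral_conv_sub_le hα h₁ h₂ h₃ hM₂ hM₃ hb Q G R h2 hm hv hαQ
      (memLp_id_gaussianReal 2) hG1 hG2 hGαi) s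
  have hGs : convPow G s = gaussianReal 0 1 := by
    rw [hG, convPow_gaussianReal, mul_inv_cancel₀ (by exact_mod_cast hs.ne')]
  rw [hGs, hGα] at hswap
  have hup : ∫ x, f x ∂(gaussianReal 0 1) ≤ 11 / 20 := by
    have : ∫ x, f x ∂(gaussianReal 0 1) ≤
        ∫ x, (Set.Ioi (-(1 / 20))).indicator (fun _ => (1 : ℝ)) x ∂(gaussianReal 0 1) := by
      refine integral_mono (hfi0 _)
        ((integrable_const _).indicator measurableSet_Ioi) fun x => ?_
      by_cases hx : x ∈ Set.Ioi (-(1 / 20 : ℝ))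
      · rw [Set.indicator_of_mem hx]; exact hf1 x
      · rw [Set.indicator_of_notMem hx]; exact (hfneg x (not_lt.1 hx)).le
    rw [integral_indicator_const _ measurableSet_Ioi] at this
    have h2 := gaussianReal_Ioi_neg_le (ε := 1 / 20) (by norm_num)
    simp only [smul_eq_mul, mul_one] at this
    linarith
  have hlow : (convPow Q s).real (Set.Ioi 0) ≤ ∫ x, f x ∂(convPow Q s) := by
    have : ∫ x, (Set.Ioi 0).indicator (fun _ => (1 : ℝ)) x ∂(convPow Q s) ≤
        ∫ x, f x ∂(convPow Q s) := by
      refine integral_mono ((integrable_const _).indicator measurableSet_Ioi) (hfi0 _) fun x => ?_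
      by_cases hx : x ∈ Set.Ioi (0 : ℝ)
      · rw [Set.indicator_of_mem hx]; exact (hfpos x (Set.mem_Ioi.1 hx).le).ge
      · rw [Set.indicator_of_notMem hx]; exact hf0 x
    rw [integral_indicator_const _ measurableSet_Ioi] at this
    simpa using this
  have hI : 0 ≤ ∫ x, |x| ^ α ∂Q := integral_nonneg fun x => by positivity
  have hle : 2 * M * ∫ x, |x| ^ α ∂Q + 2 * M * ((√(s : ℝ))⁻¹ ^ α * K) ≤
      2 * M * (1 + K) * (∫ x, |x| ^ α ∂Q + (√(s : ℝ))⁻¹ ^ α) := by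
    have h3 : 0 ≤ (√(s : ℝ))⁻¹ ^ α := by positivity
    have e : 2 * M * (1 + K) * (∫ x, |x| ^ α ∂Q + (√(s : ℝ))⁻¹ ^ α) =
      2 * M * ∫ x, |x| ^ α ∂Q + 2 * M * ((√(s : ℝ))⁻¹ ^ α * K) +
        (2 * M * (K * ∫ x, |x| ^ α ∂Q) + 2 * M * (√(s : ℝ))⁻¹ ^ α) := by ring
    rw [e]
    exact le_add_of_nonneg_right (by positivity)
  have := mul_le_mul_of_nonneg_left hle hs'.le
  linarith [(abs_le.1 hswap).2]

theorem stdDev_nonneg (P : ProbabilityMeasure ℝ) : 0 ≤ stdDev P := Real.sqrt_nonneg _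

theorem integral_sub_mean_sq {P : ProbabilityMeasure ℝ} :
    ∫ x, (x - mean P) ^ 2 ∂(P : Measure ℝ) = stdDev P ^ 2 := by
  rw [stdDev, Real.sq_sqrt (variance_nonneg _ _), variance_eq_integral measurable_id.aemeasurable]
  rfl

theorem ae_eq_mean_of_stdDev_eq_zero {P : ProbabilityMeasure ℝ} (h2 : MemLp id 2 (P : Measure ℝ))
    (h : stdDev P = 0) : ∀ᵐ x ∂(P : Measure ℝ), x = mean P := by
  have e := integral_sub_mean_sq (P := P)
  have hc : MemLp (fun x => x - mean P) 2 (P : Measure ℝ) := h2.sub (memLp_const _)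
  rw [h, zero_pow two_ne_zero, integral_eq_zero_iff_of_nonneg (fun x => sq_nonneg _)
    hc.integrable_sq] at e
  filter_upwards [e] with x hx
  exact sub_eq_zero.1 (pow_eq_zero_iff two_ne_zero |>.1 hx)

theorem ae_sampleLaw_eq_mean {P : ProbabilityMeasure ℝ} (h2 : MemLp id 2 (P : Measure ℝ))
    (h : stdDev P = 0) (n : ℕ) : ∀ᵐ x ∂(sampleLaw P n), ∀ i, x i = mean P :=
  ae_all_iff.2 fun i => (measurePreserving_eval (fun _ : Fin n => (P : Measure ℝ))
    i).quasiMeasurePreserving.ae (ae_eq_mean_of_stdDev_eq_zero h2 h)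

/-- Regularity of the laws in `momentClass α η`: sums of at least `C η ^ (2 α / (α - 2))`
independent copies are almost as likely to fall on either side of their mean. -/
theorem exists_sampleLaw_sum_pos_le {α : ℝ} (hα : 2 < α ∧ α ≤ 3) : ∃ C : ℝ, 0 < C ∧
    ∀ η : ℝ, 1 ≤ η → ∀ P ∈ momentClass α η, ∀ (n : ℕ) (F : Finset (Fin n)),
      C * η ^ (2 * α / (α - 2)) ≤ F.card → ∀ u : ℝ, |u| = 1 →
        (sampleLaw P n).real {x | 0 < ∑ i ∈ F, u * (x i - mean P)} ≤ 3 / 5 := by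
  obtain ⟨D, hD, hclt⟩ := exists_convPow_Ioi_le ⟨hα.1.le, hα.2⟩
  have hα2 : 0 < α - 2 := by linarith
  set A : ℝ := 40 * D + 1 with hA
  have hA0 : 0 < A := by positivity
  refine ⟨A ^ (2 / (α - 2)), by positivity, fun η hη P hP n F hF u hu => ?_⟩
  obtain ⟨h2, hαi, hαle⟩ := hP
  have hη0 : 0 < η := by linarith
  set s := F.card with hs
  have hs' : (0 : ℝ) < s := lt_of_lt_of_le (by positivity) hF
  have hs0 : 0 < s := by exact_mod_cast hs'
  have hsq : 0 < √(s : ℝ) := Real.sqrt_pos.2 hs'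
  have hα0 : 0 ≤ α := by linarith [hα.1]
  set σ := stdDev P with hσ
  rcases (stdDev_nonneg P).eq_or_lt with h0 | hσ0
  · -- a point mass: the sum vanishes almost surely
    have hall := ae_sampleLaw_eq_mean h2 h0.symm n
    have : (sampleLaw P n) {x | 0 < ∑ i ∈ F, u * (x i - mean P)} = 0 := by
      rw [measure_eq_zero_iff_ae_notMem]
      filter_upwards [hall] with x hx
      simp [hx]
    rw [measureReal_def, this]
    norm_num
  rw [← hσ] at hσ0
  set t : ℝ := u * (σ * √s)⁻¹ with ht
  have htabs : |t| = (σ * √s)⁻¹ := by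
    rw [ht, abs_mul, hu, one_mul, abs_of_nonneg (by positivity)]
  have htsq : t ^ 2 = (σ ^ 2 * s)⁻¹ := by
    rw [← sq_abs, htabs, inv_pow, mul_pow, Real.sq_sqrt hs'.le]
  set g : ℝ → ℝ := fun x => t * (x - mean P) with hg
  have hgm : Measurable g := by fun_prop
  set Q := (P : Measure ℝ).map g with hQ
  have : IsProbabilityMeasure Q := isProbabilityMeasure_map hgm.aemeasurable
  have hcent : MemLp (fun x => x - mean P) 2 (P : Measure ℝ) := h2.sub (memLp_const _)
  have q2 : MemLp id 2 Q := by
    rw [hQ, memLp_map_measure_iff (by fun_prop) hgm.aemeasurable]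
    exact hcent.const_mul t
  have q1 : ∫ x, x ∂Q = 0 := by
    rw [hQ, integral_map hgm.aemeasurable (by fun_prop)]
    simp only [hg]
    have hi : Integrable (fun x : ℝ => x) (P : Measure ℝ) := h2.integrable one_le_two
    rw [integral_const_mul, integral_sub hi (integrable_const _)]
    simp [mean]
  have qv : ∫ x, x ^ 2 ∂Q = (s : ℝ)⁻¹ := by
    rw [hQ, integral_map hgm.aemeasurable (by fun_prop)]
    simp only [hg, mul_pow]
    rw [integral_const_mul, integral_sub_mean_sq, htsq, ← hσ]
    field_simp
  have hpow : ∀ x, |g x| ^ α = (σ * √s)⁻¹ ^ α * |x - mean P| ^ α := fun x => by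
    simp only [hg]
    rw [abs_mul, Real.mul_rpow (abs_nonneg _) (abs_nonneg _), htabs]
  have qαi : Integrable (fun x => |x| ^ α) Q := by
    rw [hQ, integrable_map_measure (by fun_prop (disch := exact hα0)) hgm.aemeasurable]
    exact (hαi.const_mul ((σ * √s)⁻¹ ^ α)).congr (ae_of_all _ fun x => (hpow x).symm)
  have qα : ∫ x, |x| ^ α ∂Q ≤ η ^ α * (√s)⁻¹ ^ α := by
    rw [hQ, integral_map hgm.aemeasurable (by fun_prop (disch := exact hα0))]
    simp only [hpow]
    rw [integral_const_mul]
    refine (mul_le_mul_of_nonneg_left hαle (by positivity)).trans (le_of_eq ?_)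
    rw [← Real.mul_rpow (by positivity) (by positivity),
      ← Real.mul_rpow (by positivity) (by positivity)]
    congr 1
    field_simp
  have hmain := hclt Q s hs0 q2 q1 qv qαi
  have hlaw : (sampleLaw P n).real {x | 0 < ∑ i ∈ F, u * (x i - mean P)} =
      (convPow Q s).real (Set.Ioi 0) := by
    rw [hQ, hs, ← map_sum_pi_eq_convPow (P : Measure ℝ) hgm F,
      map_measureReal_apply (by fun_prop) measurableSet_Ioi]
    congr 1
    ext x
    have : ∑ i ∈ F, g (x i) = (σ * √s)⁻¹ * ∑ i ∈ F, u * (x i - mean P) := by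
      rw [Finset.mul_sum]
      exact Finset.sum_congr rfl fun i _ => by simp only [hg, ht]; ring
    simp only [Set.mem_ofPred_eq, Set.mem_preimage, Set.mem_Ioi, this]
    rw [mul_pos_iff_of_pos_left (by positivity)]
  rw [hlaw]
  refine hmain.trans ?_
  -- the size of `s` makes the error term small
  have hroot : A * η ^ α ≤ (√(s : ℝ)) ^ (α - 2) := by
    have := Real.rpow_le_rpow (by positivity) hF (z := (α - 2) / 2) (by positivity)
    rw [Real.mul_rpow (by positivity) (by positivity), ← Real.rpow_mul hA0.le,
      ← Real.rpow_mul hη0.le] at this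
    rw [show 2 / (α - 2) * ((α - 2) / 2) = 1 by field_simp,
      show 2 * α / (α - 2) * ((α - 2) / 2) = α by field_simp, Real.rpow_one] at this
    rw [Real.sqrt_eq_rpow, ← Real.rpow_mul hs'.le]
    convert this using 2
    ring
  have hsα : (s : ℝ) * (√(s : ℝ))⁻¹ ^ α = ((√(s : ℝ)) ^ (α - 2))⁻¹ := by
    rw [Real.inv_rpow hsq.le, Real.rpow_sub hsq, Real.rpow_two, Real.sq_sqrt hs'.le, inv_div]
    rfl
  have hη1 : 1 ≤ η ^ α := Real.one_le_rpow hη (by linarith)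
  have hpos : 0 < (√(s : ℝ)) ^ (α - 2) := by positivity
  have hfin : (s : ℝ) * (D * (∫ x, |x| ^ α ∂Q + (√s)⁻¹ ^ α)) ≤ 1 / 20 := by
    have h4 : ∫ x, |x| ^ α ∂Q + (√s)⁻¹ ^ α ≤ 2 * η ^ α * (√s)⁻¹ ^ α := by
      have : (√(s : ℝ))⁻¹ ^ α ≤ η ^ α * (√s)⁻¹ ^ α :=
        le_mul_of_one_le_left (by positivity) hη1
      linarith
    calc (s : ℝ) * (D * (∫ x, |x| ^ α ∂Q + (√s)⁻¹ ^ α))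
        ≤ s * (D * (2 * η ^ α * (√s)⁻¹ ^ α)) := by gcongr
      _ = 2 * D * η ^ α * (s * (√s)⁻¹ ^ α) := by ring
      _ = 2 * D * η ^ α / (√(s : ℝ)) ^ (α - 2) := by rw [hsα]; rfl
      _ ≤ 1 / 20 := by
        rw [div_le_iff₀ hpos]
        have : A * η ^ α = 40 * D * η ^ α + η ^ α := by rw [hA]; ring
        linarith
  linarith

end Lindeberg

/-! ### Independent blocks -/

instance sampleLaw.instIsProbabilityMeasure (P : ProbabilityMeasure ℝ) (n : ℕ) :
    IsProbabilityMeasure (sampleLaw P n) := by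
  unfold sampleLaw; infer_instance

@[fun_prop]
theorem measurable_blockMean {n b : ℕ} (B : Fin n → Fin b) : Measurable (blockMean B) := by
  unfold blockMean; fun_prop

/-- Means over disjoint blocks are independent. -/
theorem integral_prod_blockMean {n b : ℕ} (B : Fin n → Fin b) (P : ProbabilityMeasure ℝ)
    {φ : ℝ → ℝ} (hφ : Measurable φ) (A : Finset (Fin b)) :
    ∫ x, ∏ a ∈ A, φ (blockMean B x a) ∂(sampleLaw P n) =
      ∏ a ∈ A, ∫ x, φ (blockMean B x a) ∂(sampleLaw P n) := by
  induction A using Finset.induction_on with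
  | empty => simp
  | insert a A ha ih =>
    rw [Finset.prod_insert ha, ← ih]
    simp only [Finset.prod_insert ha]
    have hind : iIndepFun (fun (i : Fin n) (x : Fin n → ℝ) => x i) (sampleLaw P n) :=
      iIndepFun_pi (X := fun _ => id) fun _ => aemeasurable_id
    have hdisj : Disjoint ({i | B i = a} : Finset (Fin n)) ({i | B i ∈ A} : Finset (Fin n)) := by
      rw [Finset.disjoint_left]
      intro i hi hi'
      simp only [Finset.mem_filter, Finset.mem_univ, true_and] at hi hi'
      exact ha (hi ▸ hi')
    have hpair := hind.indepFun_finset _ _ hdisj fun i => measurable_pi_apply i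
    -- each block mean is a function of the coordinates in its block
    obtain ⟨F₁, hF₁, h₁⟩ : ∃ F : (({i | B i = a} : Finset (Fin n)) → ℝ) → ℝ, Measurable F ∧
        ∀ x : Fin n → ℝ, φ (blockMean B x a) = F fun i => x i := by
      refine ⟨fun y => φ ((∑ i, y i) / ({i | B i = a} : Finset (Fin n)).card), by fun_prop,
        fun x => ?_⟩
      simp only [blockMean]
      rw [← Finset.sum_coe_sort]
    obtain ⟨F₂, hF₂, h₂⟩ : ∃ F : (({i | B i ∈ A} : Finset (Fin n)) → ℝ) → ℝ, Measurable F ∧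
        ∀ x : Fin n → ℝ, ∏ c ∈ A, φ (blockMean B x c) = F fun i => x i := by
      refine ⟨fun y => ∏ c ∈ A, φ ((Finset.univ.filter fun i => B i.1 = c).sum y /
        ({i | B i = c} : Finset (Fin n)).card), by fun_prop, fun x => ?_⟩
      refine Finset.prod_congr rfl fun c hc => ?_
      simp only [blockMean]
      congr 2
      symm
      refine Finset.sum_bij (fun i _ => (i : Fin n)) ?_ ?_ ?_ ?_
      · intro i hi; simpa using hi
      · intro i _ j _ h; exact Subtype.ext h
      · intro i hi
        have hi' : B i = c := by simpa using hi
        exact ⟨⟨i, by simp [hi', hc]⟩, by simpa using hi', rfl⟩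
      · intro i _; rfl
    simp only [h₁, h₂]
    exact hpair.integral_fun_comp_mul_comp (𝕜 := ℝ) (f := F₁) (g := F₂)
      (measurable_pi_lambda _ fun i => measurable_pi_apply _).aemeasurable
      (measurable_pi_lambda _ fun i => measurable_pi_apply _).aemeasurable
      hF₁.aestronglyMeasurable hF₂.aestronglyMeasurable

open Classical in
/-- Chernoff's bound for the number of blocks whose mean falls into a set `S`. -/
theorem sampleLaw_card_blockMean_le {n b : ℕ} (B : Fin n → Fin b) (P : ProbabilityMeasure ℝ)
    {S : Set ℝ} (hS : MeasurableSet S) {p M θ : ℝ} (hM : 1 ≤ M)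
    (hp : ∀ a, (sampleLaw P n).real {x | blockMean B x a ∈ S} ≤ p) :
    (sampleLaw P n).real
        {x | θ * b ≤ ({a | blockMean B x a ∈ S} : Finset (Fin b)).card} ≤
      ((1 + (M - 1) * p) * M ^ (-θ)) ^ b := by
  have hM0 : 0 < M := by linarith
  set φ : ℝ → ℝ := fun t => 1 + S.indicator (fun _ => M - 1) t with hφ
  have hφm : Measurable φ := (measurable_const.indicator hS).const_add 1
  have hφ1 : ∀ t, t ∈ S → φ t = M := fun t ht => by simp [hφ, ht]
  have hφ2 : ∀ t, t ∉ S → φ t = 1 := fun t ht => by simp [hφ, ht]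
  have hφ0 : ∀ t, 0 ≤ φ t := fun t => by
    by_cases ht : t ∈ S
    · rw [hφ1 t ht]; exact hM0.le
    · rw [hφ2 t ht]; exact zero_le_one
  have hφM : ∀ t, φ t ≤ M := fun t => by
    by_cases ht : t ∈ S
    · rw [hφ1 t ht]
    · rw [hφ2 t ht]; exact hM
  have hprod : ∀ x : Fin n → ℝ, ∏ a, φ (blockMean B x a) =
      M ^ (({a | blockMean B x a ∈ S} : Finset (Fin b)).card : ℝ) := by
    intro x
    rw [Real.rpow_natCast, Finset.prod_congr rfl (g := fun a => if blockMean B x a ∈ S then M else 1)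
      (fun a _ => by
        split_ifs with h
        · exact hφ1 _ h
        · exact hφ2 _ h)]
    rw [Finset.prod_ite]
    simp
  have hint : Integrable (fun x => ∏ a, φ (blockMean B x a)) (sampleLaw P n) := by
    refine Integrable.of_bound (C := M ^ b) (Finset.measurable_fun_prod _ fun a _ =>
      hφm.comp (by fun_prop)).aestronglyMeasurable (ae_of_all _ fun x => ?_)
    rw [Real.norm_of_nonneg (Finset.prod_nonneg fun a _ => hφ0 _)]
    refine (Finset.prod_le_prod (fun a _ => hφ0 _) fun a _ => hφM _).trans ?_
    simp
  have hone : ∀ a, ∫ x, φ (blockMean B x a) ∂(sampleLaw P n) ≤ 1 + (M - 1) * p := by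
    intro a
    have hms : MeasurableSet {x : Fin n → ℝ | blockMean B x a ∈ S} :=
      (show Measurable fun x : Fin n → ℝ => blockMean B x a by fun_prop) hS
    have : (fun x => φ (blockMean B x a)) = fun x =>
        1 + {x : Fin n → ℝ | blockMean B x a ∈ S}.indicator (fun _ => M - 1) x := by
      ext x
      simp only [hφ, Set.indicator_apply, Set.mem_ofPred_eq]
    rw [this, integral_add (integrable_const _) ((integrable_const _).indicator hms),
      integral_indicator_const _ hms]
    simp only [integral_const, smul_eq_mul, probReal_univ, one_mul]
    have := mul_le_mul_of_nonneg_left (hp a) (sub_nonneg.2 hM)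
    linarith
  have hmarkov := mul_meas_ge_le_integral_of_nonneg
    (ae_of_all (sampleLaw P n) fun x => Finset.prod_nonneg fun a _ => hφ0 (blockMean B x a))
    hint (M ^ (θ * b))
  rw [integral_prod_blockMean B P hφm] at hmarkov
  have hle : ∏ a, ∫ x, φ (blockMean B x a) ∂(sampleLaw P n) ≤ (1 + (M - 1) * p) ^ b := by
    refine (Finset.prod_le_prod (fun a _ => integral_nonneg fun x => hφ0 _)
      fun a _ => hone a).trans ?_
    simp
  have hsub : {x | θ * b ≤ (({a | blockMean B x a ∈ S} : Finset (Fin b)).card : ℝ)} ⊆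
      {x | M ^ (θ * b) ≤ ∏ a, φ (blockMean B x a)} := by
    intro x hx
    simp only [Set.mem_ofPred_eq] at hx ⊢
    rw [hprod]
    exact Real.rpow_le_rpow_of_exponent_le hM hx
  have hpos : 0 < M ^ (θ * b) := by positivity
  have e : (M ^ (-θ)) ^ b = (M ^ (θ * b))⁻¹ := by
    rw [← Real.rpow_natCast, ← Real.rpow_mul hM0.le, ← Real.rpow_neg hM0.le]
    congr 1
    ring
  rw [mul_pow, e, ← div_eq_mul_inv, le_div_iff₀ hpos, mul_comm]
  refine (mul_le_mul_of_nonneg_left (measureReal_mono hsub) hpos.le).trans (hmarkov.trans hle)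

theorem blockMean_sub {n b : ℕ} (B : Fin n → Fin b) (x : Fin n → ℝ) (a : Fin b) (μ : ℝ)
    (ha : 0 < ({i | B i = a} : Finset (Fin n)).card) :
    blockMean B x a - μ =
      (∑ i with B i = a, (x i - μ)) / ({i | B i = a} : Finset (Fin n)).card := by
  have : (0 : ℝ) < ({i | B i = a} : Finset (Fin n)).card := by exact_mod_cast ha
  rw [blockMean, Finset.sum_sub_distrib, Finset.sum_const, nsmul_eq_mul]
  field_simp

/-- Chebyshev's inequality for a block mean, at `4 e ^ (5 / 2)` standard deviations. -/
theorem sampleLaw_blockMean_dist_le {n b : ℕ} (B : Fin n → Fin b) {P : ProbabilityMeasure ℝ}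
    (h2 : MemLp id 2 (P : Measure ℝ)) (a : Fin b) {r : ℝ} (hr : 0 < r)
    (ha : r ≤ ({i | B i = a} : Finset (Fin n)).card) :
    (sampleLaw P n).real {x | blockMean B x a ∈
      {t | 4 * Real.exp (5 / 2) * (stdDev P * (√r)⁻¹) < |t - mean P|}} ≤ Real.exp (-5) / 16 := by
  set N : ℝ := (({i | B i = a} : Finset (Fin n)).card : ℝ) with hN
  have hN0 : 0 < N := hr.trans_le ha
  rcases (stdDev_nonneg P).eq_or_lt with h0 | hσ0
  · have hall := ae_sampleLaw_eq_mean h2 h0.symm n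
    have : (sampleLaw P n) {x | blockMean B x a ∈
        {t | 4 * Real.exp (5 / 2) * (stdDev P * (√r)⁻¹) < |t - mean P|}} = 0 := by
      rw [measure_eq_zero_iff_ae_notMem]
      filter_upwards [hall] with x hx
      have hcard : 0 < ({i | B i = a} : Finset (Fin n)).card := Nat.cast_pos.1 hN0
      change ¬ _ < |blockMean B x a - mean P|
      rw [blockMean_sub B x a _ hcard]
      simp [hx, ← h0]
    rw [measureReal_def, this]
    simp only [ENNReal.toReal_zero]
    positivity
  set X : Fin n → ℝ → ℝ := fun i t => (if B i = a then N⁻¹ else 0) * t with hX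
  have hXm : ∀ i, MemLp (X i) 2 (P : Measure ℝ) := fun i => h2.const_mul _
  have hsum : (fun x => blockMean B x a) = ∑ i, fun x : Fin n → ℝ => X i (x i) := by
    ext x
    simp only [Finset.sum_apply, hX, ite_mul, zero_mul]
    rw [← Finset.sum_filter, ← Finset.mul_sum, blockMean, div_eq_inv_mul]
  have hvar : variance (fun x => blockMean B x a) (sampleLaw P n) = stdDev P ^ 2 / N := by
    rw [hsum, sampleLaw, variance_sum_pi hXm]
    have : ∀ i, variance (X i) (P : Measure ℝ) =
        if B i = a then N⁻¹ ^ 2 * stdDev P ^ 2 else 0 := by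
      intro i
      have hs : variance id (P : Measure ℝ) = stdDev P ^ 2 := by
        rw [stdDev, Real.sq_sqrt (variance_nonneg _ _)]
      rw [hX, variance_const_mul]
      change _ * variance id _ = _
      rw [hs]
      split_ifs <;> simp
    simp only [this]
    rw [← Finset.sum_filter, Finset.sum_const, nsmul_eq_mul, ← hN]
    field_simp
  have hmemi : ∀ i, MemLp (fun x : Fin n → ℝ => X i (x i)) 2 (sampleLaw P n) := fun i =>
    (hXm i).comp_measurePreserving (measurePreserving_eval (fun _ => (P : Measure ℝ)) i)
  have hmem : MemLp (fun x => blockMean B x a) 2 (sampleLaw P n) := by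
    rw [hsum]
    exact memLp_finsetSum' _ fun i _ => hmemi i
  have hmean : ∫ x, blockMean B x a ∂(sampleLaw P n) = mean P := by
    have e : ∀ i, ∫ x : Fin n → ℝ, X i (x i) ∂(sampleLaw P n) =
        if B i = a then N⁻¹ * mean P else 0 := by
      intro i
      rw [sampleLaw, integral_comp_eval (μ := fun _ => (P : Measure ℝ)) (hXm i).1]
      simp only [hX]
      rw [integral_const_mul, mean]
      split_ifs <;> simp
    have := congrFun hsum
    simp only [Finset.sum_apply] at this
    simp only [this]
    rw [integral_finsetSum _ fun i _ => (hmemi i).integrable one_le_two]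
    simp only [e]
    rw [← Finset.sum_filter, Finset.sum_const, nsmul_eq_mul, ← hN]
    field_simp
  set c := 4 * Real.exp (5 / 2) * (stdDev P * (√r)⁻¹) with hc
  have hsr : 0 < √r := Real.sqrt_pos.2 hr
  have hc0 : 0 < c := by positivity
  have hch := meas_ge_le_variance_div_sq hmem hc0
  rw [hmean, hvar] at hch
  have hcsq : c ^ 2 = 16 * Real.exp 5 * (stdDev P ^ 2 / r) := by
    rw [hc, mul_pow, mul_pow, mul_pow, inv_pow, Real.sq_sqrt hr.le, ← Real.exp_nat_mul]
    norm_num [div_eq_mul_inv]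
  rw [measureReal_def]
  refine ENNReal.toReal_le_of_le_ofReal (by positivity)
    ((measure_mono fun x hx => ?_).trans (hch.trans (ENNReal.ofReal_le_ofReal ?_)))
  · simp only [Set.mem_ofPred_eq] at hx ⊢
    exact hx.le
  · rw [hcsq, Real.exp_neg, div_le_iff₀ (by positivity)]
    have : (Real.exp 5)⁻¹ / 16 * (16 * Real.exp 5 * (stdDev P ^ 2 / r)) = stdDev P ^ 2 / r := by
      have := Real.exp_pos 5
      field_simp
    rw [this]
    gcongr

/-! ### Quantiles and the location of the estimator -/

theorem exists_isQuantileIndex {b : ℕ} (hb : 0 < b) {q : ℝ} (hq0 : 0 ≤ q) (hq : q ≤ 1) (y : Fin b → ℝ) :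
    ∃ i, IsQuantileIndex q y i := by
  have : Nonempty (Fin b) := ⟨⟨0, hb⟩⟩
  have hb' : (0 : ℝ) < b := by exact_mod_cast hb
  set T : Finset (Fin b) := Finset.univ.filter fun i =>
    q * b ≤ (({j | y j ≤ y i} : Finset (Fin b)).card : ℝ) with hT
  have hTne : T.Nonempty := by
    obtain ⟨i, -, hi⟩ := Finset.exists_max_image Finset.univ y Finset.univ_nonempty
    refine ⟨i, ?_⟩
    have : ({j | y j ≤ y i} : Finset (Fin b)) = Finset.univ := by
      ext j; simpa using hi j (Finset.mem_univ j)
    simp only [hT, Finset.mem_filter, Finset.mem_univ, true_and, this, Finset.card_univ,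
      Fintype.card_fin]
    nlinarith
  obtain ⟨i, hiT, hi⟩ := Finset.exists_min_image T y hTne
  refine ⟨i, (Finset.mem_filter.1 hiT).2, ?_⟩
  -- the entries below `y i` are fewer than `q b`
  have hlt : (({l | y l < y i} : Finset (Fin b)).card : ℝ) ≤ q * b := by
    rcases ({l | y l < y i} : Finset (Fin b)).eq_empty_or_nonempty with he | hne
    · rw [he, Finset.card_empty, Nat.cast_zero]
      positivity
    · obtain ⟨j, hj, hjmax⟩ := Finset.exists_max_image _ y hne
      have hj' : y j < y i := by simpa using hj
      have hjT : j ∉ T := fun h => (hi j h).not_gt hj'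
      have hsub : ({l | y l < y i} : Finset (Fin b)) ⊆
          ({l | y l ≤ y j} : Finset (Fin b)) := fun l hl => by
        simpa using hjmax l hl
      simp only [hT, Finset.mem_filter, Finset.mem_univ, true_and, not_le] at hjT
      exact (Nat.cast_le.2 (Finset.card_le_card hsub)).trans hjT.le
  have hadd : ({l | y l < y i} : Finset (Fin b)).card + ({l | y i ≤ y l} : Finset (Fin b)).card
      = b := by
    have := Finset.card_filter_add_card_filter_not (s := Finset.univ) (fun l : Fin b => y l < y i)
    simpa only [not_lt, Finset.card_univ, Fintype.card_fin] using this
  have : (({l | y l < y i} : Finset (Fin b)).card : ℝ) +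
      (({l | y i ≤ y l} : Finset (Fin b)).card : ℝ) = b := by exact_mod_cast hadd
  linarith

theorem exists_quantile_eq {b : ℕ} (hb : 0 < b) {q : ℝ} (hq0 : 0 ≤ q) (hq : q ≤ 1) (y : Fin b → ℝ) :
    ∃ i, IsQuantileIndex q y i ∧ quantile q y = y i := by
  classical
  have h := exists_isQuantileIndex hb hq0 hq y
  rw [quantile, dif_pos h]
  exact ⟨_, Fin.find_spec h, rfl⟩

theorem quantile_le_of_card_lt {b : ℕ} (hb : 0 < b) {q : ℝ} (hq0 : 0 ≤ q) (hq : q ≤ 1)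
    {y : Fin b → ℝ} {t : ℝ}
    (h : (({a | t < y a} : Finset (Fin b)).card : ℝ) < (1 - q) * b) : quantile q y ≤ t := by
  obtain ⟨i, hi, e⟩ := exists_quantile_eq hb hq0 hq y
  rw [e]
  by_contra hlt
  rw [not_le] at hlt
  have hsub : ({l | y i ≤ y l} : Finset (Fin b)) ⊆ ({a | t < y a} : Finset (Fin b)) := fun l hl => by
    simp only [Finset.mem_filter, Finset.mem_univ, true_and] at hl ⊢
    exact hlt.trans_le hl
  have : (({l | y i ≤ y l} : Finset (Fin b)).card : ℝ) ≤
      (({a | t < y a} : Finset (Fin b)).card : ℝ) := Nat.cast_le.2 (Finset.card_le_card hsub)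
  linarith [hi.2]

theorem le_quantile_of_card_lt {b : ℕ} (hb : 0 < b) {q : ℝ} (hq0 : 0 ≤ q) (hq : q ≤ 1)
    {y : Fin b → ℝ} {t : ℝ}
    (h : (({a | y a < t} : Finset (Fin b)).card : ℝ) < q * b) : t ≤ quantile q y := by
  obtain ⟨i, hi, e⟩ := exists_quantile_eq hb hq0 hq y
  rw [e]
  by_contra hlt
  rw [not_le] at hlt
  have hsub : ({l | y l ≤ y i} : Finset (Fin b)) ⊆ ({a | y a < t} : Finset (Fin b)) := fun l hl => by
    simp only [Finset.mem_filter, Finset.mem_univ, true_and] at hl ⊢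
    exact hl.trans_lt hlt
  have : (({l | y l ≤ y i} : Finset (Fin b)).card : ℝ) ≤
      (({a | y a < t} : Finset (Fin b)).card : ℝ) := Nat.cast_le.2 (Finset.card_le_card hsub)
  linarith [hi.1]

/-- If `μ` lies in all confidence intervals with index at least `j`, then the estimator lies in the
`j`-th interval as well. -/
theorem regularEstimator_mem_confInterval {n k j : ℕ} {B : Blocks n} {x : Fin n → ℝ} {μ : ℝ}
    (hj1 : 1 ≤ j) (hjm : j ≤ levels n k)
    (hμ : ∀ i ∈ Finset.Icc j (levels n k), μ ∈ confInterval B x i) :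
    regularEstimator k B x ∈ confInterval B x j := by
  set m := levels n k with hm
  set K := {k' | k' ∈ Finset.Icc 1 m ∧ (tailInter B m x k').Nonempty} with hK
  have hjK : j ∈ K := ⟨Finset.mem_Icc.2 ⟨hj1, hjm⟩, μ, hμ⟩
  have hfK : firstIndex B m x ∈ K := Nat.sInf_mem ⟨j, hjK⟩
  have hle : firstIndex B m x ≤ j := Nat.sInf_le hjK
  have hsub : tailInter B m x (firstIndex B m x) ⊆ confInterval B x j :=
    fun t ht => ht j (Finset.mem_Icc.2 ⟨hle, hjm⟩)
  have hne := hfK.2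
  set S := tailInter B m x (firstIndex B m x) with hS
  obtain ⟨t, ht⟩ := hne
  have hbb : BddBelow S := ⟨_, fun u hu => (hsub hu).1⟩
  have hba : BddAbove S := ⟨_, fun u hu => (hsub hu).2⟩
  have h1 : quantile (1 / 4) (blockMean (B j) x) ≤ sInf S := le_csInf ⟨t, ht⟩ fun u hu => (hsub hu).1
  have h2 : sSup S ≤ quantile (3 / 4) (blockMean (B j) x) := csSup_le ⟨t, ht⟩ fun u hu => (hsub hu).2
  have h3 : sInf S ≤ sSup S := (csInf_le hbb ht).trans (le_csSup hba ht)
  change (sInf S + sSup S) / 2 ∈ Set.Icc _ _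
  exact ⟨by linarith, by linarith⟩

/-! ### Measurability of the estimator -/

theorem measurableSet_isQuantileIndex {b : ℕ} (q : ℝ) (i : Fin b) :
    MeasurableSet {y : Fin b → ℝ | IsQuantileIndex q y i} := by
  have h1 : Measurable fun y : Fin b → ℝ => (({j | y j ≤ y i} : Finset (Fin b)).card : ℝ) := by
    simp only [Finset.card_filter, Nat.cast_sum]
    exact Finset.measurable_fun_sum _ fun j _ => (measurable_from_top (f := Nat.cast)).comp
      (Measurable.ite (measurableSet_le (measurable_pi_apply j) (measurable_pi_apply i))
        measurable_const measurable_const)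
  have h2 : Measurable fun y : Fin b → ℝ => (({l | y i ≤ y l} : Finset (Fin b)).card : ℝ) := by
    simp only [Finset.card_filter, Nat.cast_sum]
    exact Finset.measurable_fun_sum _ fun j _ => (measurable_from_top (f := Nat.cast)).comp
      (Measurable.ite (measurableSet_le (measurable_pi_apply i) (measurable_pi_apply j))
        measurable_const measurable_const)
  exact (measurableSet_le measurable_const h1).inter (measurableSet_le measurable_const h2)

@[fun_prop]
theorem measurable_quantile {b : ℕ} (q : ℝ) : Measurable (quantile (b := b) q) := by
  classical
  have e : quantile (b := b) q = fun y => ∑ i,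
      if IsQuantileIndex q y i ∧ ∀ j < i, ¬ IsQuantileIndex q y j then y i else 0 := by
    ext y
    by_cases h : ∃ i, IsQuantileIndex q y i
    · rw [quantile, dif_pos h]
      have hf := (Fin.find_eq_iff h).1 rfl
      rw [Finset.sum_eq_single (Fin.find _ h)]
      · rw [if_pos hf]
      · intro j _ hj
        rw [if_neg]
        exact fun hj' => hj ((Fin.find_eq_iff h).2 hj').symm
      · intro h; exact absurd (Finset.mem_univ _) h
    · rw [quantile, dif_neg h]
      symm
      refine Finset.sum_eq_zero fun i _ => if_neg fun hi => h ⟨i, hi.1⟩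
  rw [e]
  refine Finset.measurable_fun_sum _ fun i _ => Measurable.ite ?_ (measurable_pi_apply i)
    measurable_const
  refine (measurableSet_isQuantileIndex q i).inter ?_
  have : {y : Fin b → ℝ | ∀ j < i, ¬ IsQuantileIndex q y j} =
      ⋂ j, ⋂ _ : j < i, {y : Fin b → ℝ | IsQuantileIndex q y j}ᶜ := by
    ext y; simp
  change MeasurableSet {y : Fin b → ℝ | ∀ j < i, ¬ IsQuantileIndex q y j}
  rw [this]
  exact MeasurableSet.iInter fun j => MeasurableSet.iInter fun _ =>
    (measurableSet_isQuantileIndex q j).compl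

/-- The lower end of the intersection `tailInter B m x k'`. -/
noncomputable def tailLower {n : ℕ} (B : Blocks n) {m k' : ℕ} (h : k' ≤ m) (x : Fin n → ℝ) : ℝ :=
  (Finset.Icc k' m).sup' (Finset.nonempty_Icc.2 h) fun j => quantile (1 / 4) (blockMean (B j) x)

/-- The upper end of the intersection `tailInter B m x k'`. -/
noncomputable def tailUpper {n : ℕ} (B : Blocks n) {m k' : ℕ} (h : k' ≤ m) (x : Fin n → ℝ) : ℝ :=
  (Finset.Icc k' m).inf' (Finset.nonempty_Icc.2 h) fun j => quantile (3 / 4) (blockMean (B j) x)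

theorem tailInter_eq_Icc {n : ℕ} (B : Blocks n) {m k' : ℕ} (h : k' ≤ m) (x : Fin n → ℝ) :
    tailInter B m x k' = Set.Icc (tailLower B h x) (tailUpper B h x) := by
  ext t
  simp only [tailInter, confInterval, tailLower, tailUpper, Set.mem_ofPred_eq, Set.mem_Icc,
    Finset.sup'_le_iff, Finset.le_inf'_iff, Finset.mem_Icc]
  exact forall₂_and

theorem measurable_tailLower {n : ℕ} (B : Blocks n) {m k' : ℕ} (h : k' ≤ m) :
    Measurable (tailLower B h) := by
  have := Finset.measurable_sup' (Finset.nonempty_Icc.2 h)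
    (f := fun j (x : Fin n → ℝ) => quantile (1 / 4) (blockMean (B j) x)) fun j _ => by fun_prop
  convert this using 1
  ext x
  simp [tailLower, Finset.sup'_apply]

theorem measurable_tailUpper {n : ℕ} (B : Blocks n) {m k' : ℕ} (h : k' ≤ m) :
    Measurable (tailUpper B h) := by
  have : Measurable ((Finset.Icc k' m).inf' (Finset.nonempty_Icc.2 h)
      fun j (x : Fin n → ℝ) => quantile (3 / 4) (blockMean (B j) x)) :=
    Finset.inf'_induction _ _ (fun _ hf _ hg => Measurable.inf hf hg) fun j _ => by fun_prop
  convert this using 1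
  ext x
  simp [tailUpper, Finset.inf'_apply]

theorem tailInter_eq_univ {n : ℕ} (B : Blocks n) {m k' : ℕ} (h : m < k') (x : Fin n → ℝ) :
    tailInter B m x k' = Set.univ := by
  ext t
  simp [tailInter, Finset.Icc_eq_empty_of_lt h]

theorem measurableSet_tailInter_nonempty {n : ℕ} (B : Blocks n) (m k' : ℕ) :
    MeasurableSet {x | (tailInter B m x k').Nonempty} := by
  rcases le_or_gt k' m with h | h
  · simp only [tailInter_eq_Icc B h, Set.nonempty_Icc]
    exact measurableSet_le (measurable_tailLower B h) (measurable_tailUpper B h)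
  · simp [tailInter_eq_univ B h]

theorem measurable_firstIndex {n : ℕ} (B : Blocks n) (m : ℕ) : Measurable (firstIndex B m) := by
  -- the index depends only on which of the finitely many intersections are empty
  have e : firstIndex B m = (fun p : Fin (m + 1) → Prop =>
      sInf {k' | k' ∈ Finset.Icc 1 m ∧ ∃ h : k' < m + 1, p ⟨k', h⟩}) ∘
      fun x k' => (tailInter B m x k').Nonempty := by
    ext x
    simp only [firstIndex, Function.comp]
    congr 1
    ext k'
    simp only [Set.mem_ofPred_eq, Finset.mem_Icc, exists_prop]
    exact ⟨fun h => ⟨h.1, by omega, h.2⟩, fun h => ⟨h.1, h.2.2⟩⟩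
  rw [e]
  exact (measurable_of_countable _).comp (measurable_pi_lambda _ fun k' =>
    (measurableSet_setOfPred.1 (measurableSet_tailInter_nonempty B m k')))

theorem measurable_midpoint_tailInter {n : ℕ} (B : Blocks n) (m k' : ℕ) :
    Measurable fun x => (sInf (tailInter B m x k') + sSup (tailInter B m x k')) / 2 := by
  rcases le_or_gt k' m with h | h
  · have e : (fun x => (sInf (tailInter B m x k') + sSup (tailInter B m x k')) / 2) = fun x =>
        if tailLower B h x ≤ tailUpper B h x then (tailLower B h x + tailUpper B h x) / 2 else 0 := by
      ext x
      rw [tailInter_eq_Icc B h]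
      split_ifs with hx
      · rw [csInf_Icc hx, csSup_Icc hx]
      · rw [Set.Icc_eq_empty hx]; simp
    rw [e]
    exact Measurable.ite (measurableSet_le (measurable_tailLower B h) (measurable_tailUpper B h))
      (((measurable_tailLower B h).add (measurable_tailUpper B h)).div_const 2) measurable_const
  · simp only [tailInter_eq_univ B h]
    exact measurable_const

theorem measurable_regularEstimator {n k : ℕ} (B : Blocks n) :
    Measurable (regularEstimator k B) := by
  unfold regularEstimator
  generalize levels n k = m
  have hpair : Measurable fun p : ℕ × (Fin n → ℝ) =>
      (sInf (tailInter B m p.2 p.1) + sSup (tailInter B m p.2 p.1)) / 2 :=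
    measurable_from_prod_countable_right (measurable_midpoint_tailInter B m)
  exact hpair.comp (g := fun p : ℕ × (Fin n → ℝ) =>
    (sInf (tailInter B m p.2 p.1) + sSup (tailInter B m p.2 p.1)) / 2)
    (f := fun x => (firstIndex B m x, x)) ((measurable_firstIndex B m).prodMk measurable_id)

/-! ### The estimator is sub-Gaussian -/

theorem pow_blockCount_le {t δ : ℝ} (ht : 0 ≤ t) (h : t ≤ Real.exp (-1 / 62)) (hδ : 0 < δ) :
    t ^ blockCount δ ≤ δ / 3 := by
  calc t ^ blockCount δ ≤ Real.exp (-1 / 62) ^ blockCount δ := pow_le_pow_left₀ ht h _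
    _ = Real.exp (-(blockCount δ / 62)) := by rw [← Real.exp_nat_mul]; congr 1; ring
    _ ≤ Real.exp (-Real.log (3 / δ)) := by
      have := Nat.le_ceil (62 * Real.log (3 / δ))
      apply Real.exp_le_exp.2
      rw [blockCount]
      linarith
    _ = δ / 3 := by rw [← Real.log_inv, Real.exp_log (by positivity), inv_div]

theorem blockCount_half_pow_le (j : ℕ) :
    (blockCount ((1 / 2) ^ j) : ℝ) ≤ 1 + 62 * Real.log 3 + 62 * (j * Real.log 2) := by
  have e : Real.log (3 / (1 / 2 : ℝ) ^ j) = Real.log 3 + j * Real.log 2 := by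
    rw [Real.log_div (by norm_num) (by positivity), Real.log_pow, one_div, Real.log_inv]
    ring
  have h0 : 0 ≤ 62 * Real.log (3 / (1 / 2 : ℝ) ^ j) := by
    rw [e]
    have := Real.log_nonneg (show (1 : ℝ) ≤ 3 by norm_num)
    have := Real.log_nonneg (show (1 : ℝ) ≤ 2 by norm_num)
    positivity
  have := Nat.ceil_lt_add_one h0
  rw [blockCount]
  rw [e] at this ⊢
  linarith

theorem levels_bounds {n k : ℕ} (hk : 0 < k) (hn : (3 + Real.log 4) * 124 * k ≤ n) :
    1 ≤ levels n k ∧ (levels n k + 1) * Real.log 2 ≤ n / (124 * k) - 3 ∧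
      (1 / 2 : ℝ) ^ levels n k ≤ deltaMin n k := by
  have hk' : (0 : ℝ) < k := by exact_mod_cast hk
  have h2 : 0 < Real.log 2 := Real.log_pos (by norm_num)
  have h4 : Real.log 4 = 2 * Real.log 2 := by
    rw [show (4 : ℝ) = 2 ^ 2 by norm_num, Real.log_pow]; norm_num
  set t : ℝ := n / (124 * k) - 3 with ht
  have ht2 : 2 * Real.log 2 ≤ t := by
    have : 3 + Real.log 4 ≤ n / (124 * k) := by
      rw [le_div_iff₀ (by positivity)]; linarith
    linarith
  have e : Real.logb 2 (1 / Real.exp (3 - n / (124 * k))) = t / Real.log 2 := by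
    rw [Real.logb, one_div, ← Real.exp_neg, Real.log_exp]
    congr 1
    ring
  set F := ⌊t / Real.log 2⌋₊ with hF
  have hlev : levels n k = F - 1 := by rw [levels, e]
  have hF2 : 2 ≤ F := Nat.le_floor (by rw [le_div_iff₀ h2]; exact_mod_cast ht2)
  have hF' : ((levels n k : ℕ) : ℝ) + 1 = F := by
    rw [hlev]; exact_mod_cast Nat.sub_add_cancel (by omega : 1 ≤ F)
  refine ⟨by omega, ?_, ?_⟩
  · rw [hF', ← le_div_iff₀ h2]
    exact Nat.floor_le (div_nonneg (by linarith) h2.le)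
  · have hlt : t < (levels n k + 2) * Real.log 2 := by
      rw [← div_lt_iff₀ h2]
      have := Nat.lt_floor_add_one (t / Real.log 2)
      rw [← hF] at this
      linarith
    have e2 : (1 / 2 : ℝ) ^ levels n k = 4 * Real.exp (-((levels n k + 2) * Real.log 2)) := by
      rw [show -((levels n k + 2 : ℝ) * Real.log 2) = -(((levels n k + 2 : ℕ) : ℝ) * Real.log 2) by
        push_cast; ring, Real.exp_neg, Real.exp_nat_mul, Real.exp_log (by norm_num), pow_add]
      rw [one_div, inv_pow, mul_inv]
      ring
    rw [e2, deltaMin]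
    gcongr
    linarith

/-- At the levels used by the estimator, the blocks are long. -/
theorem mul_blockCount_le {n k j : ℕ} (hk : 0 < k) (hn : (3 + Real.log 4) * 124 * k ≤ n)
    (hj : j ≤ levels n k) : k * blockCount ((1 / 2) ^ j) ≤ n := by
  have hk' : (0 : ℝ) < k := by exact_mod_cast hk
  have h2 : 0 < Real.log 2 := Real.log_pos (by norm_num)
  have h3 : Real.log 3 ≤ 2 := (Real.log_le_sub_one_of_pos (by norm_num)).trans (by norm_num)
  obtain ⟨-, hm, -⟩ := levels_bounds hk hn
  have hb := blockCount_half_pow_le j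
  have hjm : (j : ℝ) * Real.log 2 ≤ levels n k * Real.log 2 := by
    gcongr
  have : (blockCount ((1 / 2) ^ j) : ℝ) ≤ n / k := by
    have e : (n : ℝ) / (124 * k) = n / k / 124 := by field_simp
    have : 0 ≤ (n : ℝ) / k := by positivity
    rw [e] at hm
    linarith
  rw [le_div_iff₀ hk'] at this
  have h' : (blockCount ((1 / 2) ^ j) * k : ℝ) ≤ n := this
  rw [mul_comm]
  exact_mod_cast h'

theorem half_div_le_natDiv {n b : ℕ} (hb : 0 < b) (h : b ≤ n) :
    (n : ℝ) / (2 * b) ≤ ((n / b : ℕ) : ℝ) := by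
  have hb' : (0 : ℝ) < b := by exact_mod_cast hb
  have h1 : 1 ≤ n / b := (Nat.le_div_iff_mul_le hb).2 (by simpa using h)
  have h2 : n < b * (n / b + 1) := Nat.lt_mul_div_succ n hb
  rw [div_le_iff₀ (by positivity)]
  have : n ≤ (n / b) * (2 * b) := by nlinarith
  exact_mod_cast this

/-- The confidence interval at level `2⁻ʲ` misses the mean with probability at most
`2 / 3 * 2⁻ʲ`. -/
theorem sampleLaw_mean_notMem_le {n j : ℕ} (B : Blocks n) (P : ProbabilityMeasure ℝ)
    (hcard : ∀ a, 0 < ({i | B j i = a} : Finset (Fin n)).card)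
    (hreg : ∀ a, ∀ u : ℝ, |u| = 1 →
      (sampleLaw P n).real {x | 0 < ∑ i with B j i = a, u * (x i - mean P)} ≤ 3 / 5) :
    (sampleLaw P n).real {x | mean P ∉ confInterval B x j} ≤ 2 / 3 * (1 / 2) ^ j := by
  classical
  have hpos := blockCount_pos j
  set b := blockCount ((1 / 2) ^ j) with hb
  have hnum : (1 + (2 - 1) * (3 / 5)) * (2 : ℝ) ^ (-(3 / 4) : ℝ) ≤ Real.exp (-1 / 62) := by
    have hu : ((2 : ℝ) ^ (-(3 / 4) : ℝ)) ^ 4 = 1 / 8 := by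
      rw [← Real.rpow_natCast, ← Real.rpow_mul (by norm_num)]
      rw [show (-(3 / 4) : ℝ) * ((4 : ℕ) : ℝ) = -((3 : ℕ) : ℝ) by norm_num,
        Real.rpow_neg (by norm_num), Real.rpow_natCast]
      norm_num
    refine le_of_pow_le_pow_left₀ (n := 4) (by norm_num) (Real.exp_pos _).le ?_
    rw [mul_pow, hu, ← Real.exp_nat_mul]
    have := Real.add_one_le_exp (((4 : ℕ) : ℝ) * (-1 / 62))
    refine le_trans ?_ this
    norm_num
  have hside : ∀ u : ℝ, |u| = 1 → (sampleLaw P n).real {x | 3 / 4 * (b : ℝ) ≤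
      ({a | blockMean (B j) x a ∈ {t | 0 < u * (t - mean P)}} : Finset (Fin b)).card} ≤
        (1 / 2) ^ j / 3 := by
    intro u hu
    refine (sampleLaw_card_blockMean_le (B j) P (measurableSet_lt measurable_const (by fun_prop))
      (p := 3 / 5) (M := 2) (by norm_num) fun a => ?_).trans
      (pow_blockCount_le (by positivity) hnum (by positivity))
    convert hreg a u hu using 3
    ext x
    have hc : (0 : ℝ) < ({i | B j i = a} : Finset (Fin n)).card := by exact_mod_cast hcard a
    change 0 < u * (blockMean (B j) x a - mean P) ↔ 0 < ∑ i with B j i = a, u * (x i - mean P)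
    rw [blockMean_sub _ _ _ _ (hcard a), ← Finset.mul_sum, ← mul_div_assoc]
    exact div_pos_iff_of_pos_right hc
  have hsub : {x | mean P ∉ confInterval B x j} ⊆
      {x | 3 / 4 * (b : ℝ) ≤
        ({a | blockMean (B j) x a ∈ {t | 0 < 1 * (t - mean P)}} : Finset (Fin b)).card} ∪
      {x | 3 / 4 * (b : ℝ) ≤
        ({a | blockMean (B j) x a ∈ {t | 0 < -1 * (t - mean P)}} : Finset (Fin b)).card} := by
    intro x hx
    by_contra hcon
    simp only [Set.mem_union, Set.mem_ofPred_eq, not_or, not_le] at hcon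
    refine hx ⟨quantile_le_of_card_lt hpos (by norm_num) (by norm_num)
      (lt_of_le_of_lt ?_ (hcon.1.trans_eq (by norm_num))),
      le_quantile_of_card_lt hpos (by norm_num) (by norm_num) (lt_of_le_of_lt ?_ hcon.2)⟩
    all_goals
      refine Nat.cast_le.2 (Finset.card_le_card fun a ha => ?_)
      simp only [Finset.mem_filter, Finset.mem_univ, true_and] at ha ⊢
      linarith
  refine (measureReal_mono hsub).trans ((measureReal_union_le _ _).trans ?_)
  linarith [hside 1 (by simp), hside (-1) (by simp)]

/-- The confidence interval at level `2⁻ʲ` is short, up to an event of probability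
`1 / 3 * 2⁻ʲ`. -/
theorem sampleLaw_confInterval_not_subset_le {n j : ℕ} (B : Blocks n) {P : ProbabilityMeasure ℝ}
    (h2 : MemLp id 2 (P : Measure ℝ)) {r : ℝ} (hr : 0 < r)
    (hcard : ∀ a, r ≤ ({i | B j i = a} : Finset (Fin n)).card) :
    (sampleLaw P n).real {x | ¬ ∀ t ∈ confInterval B x j,
      |t - mean P| ≤ 4 * Real.exp (5 / 2) * (stdDev P * (√r)⁻¹)} ≤ 1 / 3 * (1 / 2) ^ j := by
  classical
  have hpos := blockCount_pos j
  set b := blockCount ((1 / 2) ^ j) with hb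
  have hb' : (0 : ℝ) < b := by exact_mod_cast hpos
  set ε := 4 * Real.exp (5 / 2) * (stdDev P * (√r)⁻¹) with hε
  have hnum : (1 + (Real.exp 5 - 1) * (Real.exp (-5) / 16)) * Real.exp 5 ^ (-(1 / 4) : ℝ) ≤
      Real.exp (-1 / 62) := by
    rw [← Real.exp_mul]
    have h1 : 1 + (Real.exp 5 - 1) * (Real.exp (-5) / 16) ≤ Real.exp (1 / 16) := by
      have e : Real.exp 5 * Real.exp (-5) = 1 := by rw [← Real.exp_add]; simp
      have := Real.add_one_le_exp (1 / 16 : ℝ)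
      have := Real.exp_pos (-5)
      nlinarith
    refine (mul_le_mul_of_nonneg_right h1 (Real.exp_pos _).le).trans ?_
    rw [← Real.exp_add]
    apply Real.exp_le_exp.2
    norm_num
  have hcount : (sampleLaw P n).real {x | 1 / 4 * (b : ℝ) ≤
      ({a | blockMean (B j) x a ∈ {t | ε < |t - mean P|}} : Finset (Fin b)).card} ≤
        (1 / 2) ^ j / 3 := by
    have h1 : 1 ≤ Real.exp 5 := Real.one_le_exp (by norm_num)
    refine (sampleLaw_card_blockMean_le (B j) P (measurableSet_lt measurable_const (by fun_prop))
      (p := Real.exp (-5) / 16) (M := Real.exp 5) h1 fun a =>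
        sampleLaw_blockMean_dist_le (B j) h2 a hr (hcard a)).trans
      (pow_blockCount_le ?_ hnum (by positivity))
    have : 0 ≤ Real.exp 5 - 1 := by linarith
    positivity
  have hsub : {x | ¬ ∀ t ∈ confInterval B x j, |t - mean P| ≤ ε} ⊆ {x | 1 / 4 * (b : ℝ) ≤
      ({a | blockMean (B j) x a ∈ {t | ε < |t - mean P|}} : Finset (Fin b)).card} := by
    intro x hx
    by_contra hcon
    simp only [Set.mem_ofPred_eq, not_le] at hcon
    refine hx fun t ht => abs_le.2 ⟨?_, ?_⟩
    · have : mean P - ε ≤ quantile (1 / 4) (blockMean (B j) x) := by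
        refine le_quantile_of_card_lt hpos (by norm_num) (by norm_num) (lt_of_le_of_lt ?_ hcon)
        refine Nat.cast_le.2 (Finset.card_le_card fun a ha => ?_)
        simp only [Finset.mem_filter, Finset.mem_univ, true_and] at ha ⊢
        exact lt_abs.2 (Or.inr (by linarith))
      linarith [ht.1]
    · have : quantile (3 / 4) (blockMean (B j) x) ≤ mean P + ε := by
        refine quantile_le_of_card_lt hpos (by norm_num) (by norm_num) (lt_of_le_of_lt ?_
          (hcon.trans_eq (by norm_num)))
        refine Nat.cast_le.2 (Finset.card_le_card fun a ha => ?_)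
        simp only [Finset.mem_filter, Finset.mem_univ, true_and] at ha ⊢
        exact lt_abs.2 (Or.inl (by linarith))
      linarith [ht.2]
  refine (measureReal_mono hsub).trans (hcount.trans_eq (by ring))

theorem sum_Icc_half_pow {j m : ℕ} (h : j ≤ m) :
    ∑ i ∈ Finset.Icc j m, (1 / 2 : ℝ) ^ i = 2 * (1 / 2) ^ j - (1 / 2) ^ m := by
  induction m, h using Nat.le_induction with
  | base => simp; ring
  | succ m hm ih => rw [Finset.sum_Icc_succ_top (by omega), ih, pow_succ]; ring

/-- The level at which the estimator is analysed for the confidence parameter `δ`: the tail of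
failure probabilities is at most `δ`, while `2⁻ʲ` is comparable with `δ`. -/
theorem exists_level {m : ℕ} (hm : 1 ≤ m) {δ : ℝ} (hδm : (1 / 2) ^ m ≤ δ) (hδ1 : δ < 1) :
    ∃ j, 1 ≤ j ∧ j ≤ m ∧ δ ≤ 4 * (1 / 2) ^ j ∧
      ∑ i ∈ Finset.Icc j m, 2 / 3 * (1 / 2 : ℝ) ^ i + 1 / 3 * (1 / 2) ^ j ≤ δ := by
  rcases lt_or_ge δ (2 * (1 / 2) ^ m) with h | h
  · have h0 : (0 : ℝ) < (1 / 2) ^ m := by positivity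
    refine ⟨m, hm, le_rfl, by linarith, ?_⟩
    rw [← Finset.mul_sum, sum_Icc_half_pow le_rfl]
    linarith
  · classical
    have hex : ∃ j : ℕ, 2 * (1 / 2 : ℝ) ^ j ≤ δ := ⟨m, h⟩
    set j := Nat.find hex with hj
    have hjs : 2 * (1 / 2 : ℝ) ^ j ≤ δ := Nat.find_spec hex
    have hjm : j ≤ m := Nat.find_min' hex h
    have hj2 : 1 < j := by
      by_contra hle
      have : (1 / 2 : ℝ) ^ 1 ≤ (1 / 2) ^ j :=
        pow_le_pow_of_le_one (by norm_num) (by norm_num) (not_lt.1 hle)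
      linarith
    have hprev : δ < 2 * (1 / 2 : ℝ) ^ (j - 1) :=
      not_le.1 (Nat.find_min hex (by omega : j - 1 < Nat.find hex))
    have e : (1 / 2 : ℝ) ^ j = (1 / 2) ^ (j - 1) * (1 / 2) := by
      rw [← pow_succ]; congr 1; omega
    refine ⟨j, by omega, hjm, by linarith, ?_⟩
    have h0 : (0 : ℝ) < (1 / 2) ^ m := by positivity
    have h0 : (0 : ℝ) < (1 / 2) ^ j := by positivity
    rw [← Finset.mul_sum, sum_Icc_half_pow hjm]
    linarith

theorem deviation_ge {n j : ℕ} (hn : 0 < n) (P : ProbabilityMeasure ℝ) {δ : ℝ} (hδ0 : 0 < δ)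
    (hδ1 : δ < 1) (hj : δ ≤ 4 * (1 / 2) ^ j) :
    4 * Real.exp (5 / 2) * (stdDev P * (√((n : ℝ) / (2 * blockCount ((1 / 2) ^ j))))⁻¹) ≤
      deviation LStar P n δ := by
  have hn' : (0 : ℝ) < n := by exact_mod_cast hn
  have hb := blockCount_half_pow_le j
  have hb0 : (0 : ℝ) < blockCount ((1 / 2) ^ j) := by exact_mod_cast blockCount_pos j
  set b : ℝ := (blockCount ((1 / 2) ^ j) : ℝ) with hbdef
  have h2 : 0 < Real.log 2 := Real.log_pos (by norm_num)
  have h3 : 1 ≤ Real.log 3 := by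
    rw [Real.le_log_iff_exp_le (by norm_num)]
    exact Real.exp_one_lt_d9.le.trans (by norm_num)
  set l := Real.log (1 / δ) with hl
  have hl0 : 0 ≤ l := Real.log_nonneg (by rw [le_div_iff₀ hδ0]; linarith)
  have hjl : j * Real.log 2 ≤ 2 * Real.log 2 + l := by
    have := Real.log_le_log hδ0 hj
    rw [Real.log_mul (by norm_num) (by positivity), Real.log_pow, one_div, Real.log_inv,
      show (4 : ℝ) = 2 ^ 2 by norm_num, Real.log_pow] at this
    rw [hl, one_div, Real.log_inv]
    push_cast at this
    linarith
  have hbl : b ≤ (1 + 2 * Real.log 2) * (1 + 62 * Real.log 3) * (1 + l) := by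
    have h5 : 0 ≤ Real.log 2 * (Real.log 3 - 1) := mul_nonneg h2.le (by linarith)
    have h6 : 0 ≤ l * (Real.log 3 - 1) := mul_nonneg hl0 (by linarith)
    have h7 : 0 ≤ l * Real.log 2 := mul_nonneg hl0 h2.le
    have h8 : 0 ≤ l * (Real.log 2 * Real.log 3) := by positivity
    nlinarith
  have e1 : (√((n : ℝ) / (2 * b)))⁻¹ = √(2 * b / n) := by
    rw [← Real.sqrt_inv, inv_div]
  rw [e1, deviation, LStar]
  have key : √(2 * b / n) ≤
      √(2 * (1 + 2 * Real.log 2) * (1 + 62 * Real.log 3)) * √((1 + l) / n) := by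
    rw [← Real.sqrt_mul (by positivity)]
    apply Real.sqrt_le_sqrt
    rw [← mul_div_assoc]
    exact div_le_div_of_nonneg_right (by linarith) hn'.le
  calc 4 * Real.exp (5 / 2) * (stdDev P * √(2 * b / n))
      ≤ 4 * Real.exp (5 / 2) * (stdDev P *
        (√(2 * (1 + 2 * Real.log 2) * (1 + 62 * Real.log 3)) * √((1 + l) / n))) := by
        have := stdDev_nonneg P
        gcongr
    _ = _ := by ring

/-- The `k`-regular estimator is sub-Gaussian for every family whose sums of at least `k` terms are
almost as likely to fall on either side of their mean. -/
theorem isMultipleDelta_regularEstimator {n k : ℕ} {Ps : Set (ProbabilityMeasure ℝ)} (hk : 0 < k)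
    (hn : (3 + Real.log 4) * 124 * k ≤ n) (h2 : ∀ P ∈ Ps, MemLp id 2 (P : Measure ℝ))
    (hreg : ∀ P ∈ Ps, ∀ F : Finset (Fin n), k ≤ F.card → ∀ u : ℝ, |u| = 1 →
      (sampleLaw P n).real {x | 0 < ∑ i ∈ F, u * (x i - mean P)} ≤ 3 / 5)
    {B : Blocks n} (hB : B.Balanced) :
    IsMultipleDelta LStar Ps n (deltaMin n k) (regularEstimator k B) := by
  refine ⟨measurable_regularEstimator B, fun P hP δ hδ => ?_⟩
  have hk' : (0 : ℝ) < k := by exact_mod_cast hk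
  obtain ⟨hm1, -, hmδ⟩ := levels_bounds hk hn
  have hδ0 : 0 < δ := lt_of_lt_of_le (by unfold deltaMin; positivity) hδ.1
  have hn' : 0 < n := by
    have : (0 : ℝ) < n := lt_of_lt_of_le (by
      have := Real.log_nonneg (show (1 : ℝ) ≤ 4 by norm_num)
      positivity) hn
    exact_mod_cast this
  obtain ⟨j, hj1, hjm, hj4, hjsum⟩ := exists_level hm1 (hmδ.trans hδ.1) hδ.2
  have hdivk : ∀ i ≤ levels n k, k ≤ n / blockCount ((1 / 2) ^ i) := fun i hi =>
    (Nat.le_div_iff_mul_le (blockCount_pos i)).2 (mul_blockCount_le hk hn hi)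
  have hmiss : ∀ i ∈ Finset.Icc j (levels n k),
      (sampleLaw P n).real {x | mean P ∉ confInterval B x i} ≤ 2 / 3 * (1 / 2) ^ i := by
    intro i hi
    have hik := hdivk i (Finset.mem_Icc.1 hi).2
    exact sampleLaw_mean_notMem_le B P (fun a => by have := hB i a; omega)
      fun a u hu => hreg P hP _ (hik.trans (hB i a)) u hu
  have hb0 : (0 : ℝ) < blockCount ((1 / 2) ^ j) := by exact_mod_cast blockCount_pos j
  have hbn : blockCount ((1 / 2) ^ j) ≤ n := by
    have := mul_blockCount_le hk hn hjm
    exact le_trans (Nat.le_mul_of_pos_left _ hk) this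
  have hfar := sampleLaw_confInterval_not_subset_le (j := j) B (h2 P hP)
    (r := (n : ℝ) / (2 * blockCount ((1 / 2) ^ j))) (by positivity) fun a =>
      (half_div_le_natDiv (blockCount_pos j) hbn).trans (by exact_mod_cast hB j a)
  have hdev := deviation_ge hn' P hδ0 hδ.2 hj4
  rw [ENNReal.le_ofReal_iff_toReal_le (measure_ne_top _ _) hδ0.le, ← measureReal_def]
  have hsub : {x | deviation LStar P n δ < |regularEstimator k B x - mean P|} ⊆
      (⋃ i ∈ Finset.Icc j (levels n k), {x | mean P ∉ confInterval B x i}) ∪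
      {x | ¬ ∀ t ∈ confInterval B x j, |t - mean P| ≤ 4 * Real.exp (5 / 2) *
        (stdDev P * (√((n : ℝ) / (2 * blockCount ((1 / 2) ^ j))))⁻¹)} := by
    intro x hx
    have hx' : deviation LStar P n δ < |regularEstimator k B x - mean P| := hx
    by_contra hcon
    rw [Set.mem_union, not_or] at hcon
    have hc1 : ∀ i ∈ Finset.Icc j (levels n k), mean P ∈ confInterval B x i := by
      intro i hi
      by_contra hni
      exact hcon.1 (Set.mem_biUnion hi hni)
    have hc2 := not_not.1 hcon.2
    have := hc2 _ (regularEstimator_mem_confInterval hj1 hjm hc1)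
    exact absurd (hx'.trans_le (this.trans hdev)) (lt_irrefl _)
  calc (sampleLaw P n).real {x | deviation LStar P n δ < |regularEstimator k B x - mean P|}
      ≤ _ := measureReal_mono hsub
    _ ≤ _ := measureReal_union_le _ _
    _ ≤ ∑ i ∈ Finset.Icc j (levels n k), 2 / 3 * (1 / 2 : ℝ) ^ i + 1 / 3 * (1 / 2) ^ j :=
      add_le_add ((measureReal_biUnion_finset_le _ _).trans (Finset.sum_le_sum hmiss)) hfar
    _ ≤ δ := hjsum

/-! ### Laws of bounded kurtosis and the two-point argument -/

/-- A bound on the kurtosis implies a bound on the lower order moments, by Young's inequality. -/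
theorem mem_momentClass_of_kurtosis_le {α η M : ℝ} (hα : 2 < α ∧ α ≤ 3) (hη : 0 < η)
    {P : ProbabilityMeasure ℝ} (h2 : MemLp id 2 (P : Measure ℝ)) (hσ : 0 < stdDev P) (hM : 0 < M)
    (hi : Integrable (fun x => (x - mean P) ^ 4) (P : Measure ℝ))
    (hle : ∫ x, (x - mean P) ^ 4 ∂(P : Measure ℝ) ≤ M * stdDev P ^ 4)
    (hMη : M ≤ η ^ (2 * α / (α - 2))) : P ∈ momentClass α η := by
  set σ := stdDev P with hσd
  set θ : ℝ := (α - 2) / 2 with hθ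
  have hθ0 : 0 < θ := by rw [hθ]; linarith [hα.1]
  have hθ1 : θ ≤ 1 := by rw [hθ]; linarith [hα.2]
  set c : ℝ := M * σ ^ 2 with hc
  have hc0 : 0 < c := by positivity
  have hα0 : 0 ≤ α := by linarith [hα.1]
  have hcent : MemLp (fun x => x - mean P) 2 (P : Measure ℝ) := h2.sub (memLp_const _)
  have hi2 := hcent.integrable_sq
  have hpt : ∀ x, |x - mean P| ^ α ≤
      c ^ (θ - 1) * (θ * (x - mean P) ^ 4 + (1 - θ) * c * (x - mean P) ^ 2) := by
    intro x
    set y := x - mean P with hy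
    have hy2 : 0 ≤ y ^ 2 := sq_nonneg y
    have e : |y| ^ α = y ^ 2 * (y ^ 2) ^ θ := by
      rcases eq_or_ne y 0 with h | h
      · rw [h, abs_zero, Real.zero_rpow (by linarith [hα.1])]; simp
      · have hp : 0 < |y| := abs_pos.2 h
        have h1 : y ^ 2 = |y| ^ (2 : ℝ) := by rw [Real.rpow_two, sq_abs]
        rw [h1, ← Real.rpow_mul hp.le, ← Real.rpow_add hp]
        congr 1
        rw [hθ]; ring
    have hyoung := Real.geom_mean_le_arith_mean2_weighted hθ0.le (sub_nonneg.2 hθ1) hy2 hc0.le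
      (by ring)
    have hu : (y ^ 2) ^ θ ≤ c ^ (θ - 1) * (θ * y ^ 2 + (1 - θ) * c) := by
      calc (y ^ 2) ^ θ = c ^ (θ - 1) * ((y ^ 2) ^ θ * c ^ (1 - θ)) := by
            have : c ^ (θ - 1) * c ^ (1 - θ) = 1 := by rw [← Real.rpow_add hc0]; simp
            linear_combination (-(y ^ 2) ^ θ) * this
        _ ≤ _ := by gcongr
    rw [e]
    refine (mul_le_mul_of_nonneg_left hu hy2).trans (le_of_eq (by ring))
  have hint : Integrable (fun x => c ^ (θ - 1) *
      (θ * (x - mean P) ^ 4 + (1 - θ) * c * (x - mean P) ^ 2)) (P : Measure ℝ) :=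
    ((hi.const_mul θ).add (hi2.const_mul ((1 - θ) * c))).const_mul _
  have hαi : Integrable (fun x => |x - mean P| ^ α) (P : Measure ℝ) := by
    refine hint.mono' (Measurable.aestronglyMeasurable (by fun_prop)) (ae_of_all _ fun x => ?_)
    rw [Real.norm_of_nonneg (by positivity)]
    exact hpt x
  refine ⟨h2, hαi, (integral_mono hαi hint hpt).trans ?_⟩
  rw [integral_const_mul, integral_add (hi.const_mul θ) (hi2.const_mul ((1 - θ) * c)),
    integral_const_mul, integral_const_mul, integral_sub_mean_sq, ← hσd]
  have hMθ : M ^ θ ≤ η ^ α := by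
    have := Real.rpow_le_rpow hM.le hMη hθ0.le
    rwa [← Real.rpow_mul hη.le, show 2 * α / (α - 2) * θ = α by
      rw [hθ]; have : α - 2 ≠ 0 := by linarith [hα.1]
      field_simp] at this
  have e1 : c ^ (θ - 1) * (c * σ ^ 2) = M ^ θ * σ ^ α := by
    have h1 : c ^ (θ - 1) * c = c ^ θ := by
      rw [← Real.rpow_add_one hc0.ne']; congr 1; ring
    have h2 : c ^ θ = M ^ θ * σ ^ (2 * θ) := by
      rw [hc, Real.mul_rpow hM.le (by positivity), ← Real.rpow_two, ← Real.rpow_mul hσ.le]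
    rw [← mul_assoc, h1, h2, mul_assoc, ← Real.rpow_two, ← Real.rpow_add hσ]
    congr 2
    rw [hθ]; ring
  calc c ^ (θ - 1) * (θ * ∫ x, (x - mean P) ^ 4 ∂(P : Measure ℝ) + (1 - θ) * c * σ ^ 2)
      ≤ c ^ (θ - 1) * (θ * (M * σ ^ 4) + (1 - θ) * c * σ ^ 2) := by gcongr
    _ = c ^ (θ - 1) * (c * σ ^ 2) := by rw [hc]; ring
    _ = M ^ θ * σ ^ α := e1
    _ ≤ η ^ α * σ ^ α := by gcongr
    _ = (η * σ) ^ α := (Real.mul_rpow hη.le hσ.le).symm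

/-- The threshold on `η` guarantees that kurtosis `18` is allowed. -/
theorem eighteen_le_rpow {α η : ℝ} (hα : 2 < α ∧ α ≤ 3)
    (hη : (3 : ℝ) ^ (1 / 3 : ℝ) * (2 : ℝ) ^ (1 / 6 : ℝ) ≤ η) :
    1 ≤ η ∧ 18 ≤ η ^ (2 * α / (α - 2)) := by
  have h3 : (1 : ℝ) ≤ 3 ^ (1 / 3 : ℝ) := Real.one_le_rpow (by norm_num) (by norm_num)
  have h2 : (1 : ℝ) ≤ 2 ^ (1 / 6 : ℝ) := Real.one_le_rpow (by norm_num) (by norm_num)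
  have h1 : 1 ≤ η := (one_le_mul_of_one_le_of_one_le h3 h2).trans hη
  refine ⟨h1, ?_⟩
  have h6 : 18 ≤ η ^ (6 : ℝ) := by
    have := Real.rpow_le_rpow (by positivity) hη (show (0 : ℝ) ≤ 6 by norm_num)
    rw [Real.mul_rpow (by positivity) (by positivity), ← Real.rpow_mul (by norm_num),
      ← Real.rpow_mul (by norm_num)] at this
    norm_num at this
    exact_mod_cast this
  refine h6.trans (Real.rpow_le_rpow_of_exponent_le h1 ?_)
  rw [le_div_iff₀ (by linarith [hα.1])]
  linarith [hα.2]

/-- Le Cam's two-point argument, with a one-sided bound `K` for the likelihood ratio on the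
event `G`. -/
theorem two_point_le {n : ℕ} {E : (Fin n → ℝ) → ℝ} (hE : Measurable E)
    {P₀ P₁ : ProbabilityMeasure ℝ} {d₀ d₁ δ₀ δ₁ γ K : ℝ} {G : Set (Fin n → ℝ)}
    (hδ₀ : 0 ≤ δ₀) (hδ₁ : 0 ≤ δ₁) (hK0 : 0 ≤ K)
    (h₀ : sampleLaw P₀ n {x | d₀ < |E x - mean P₀|} ≤ ENNReal.ofReal δ₀)
    (h₁ : sampleLaw P₁ n {x | d₁ < |E x - mean P₁|} ≤ ENNReal.ofReal δ₁)
    (hG : (sampleLaw P₁ n).real Gᶜ ≤ γ)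
    (hK : ∀ A, MeasurableSet A → (sampleLaw P₁ n).real (A ∩ G) ≤ K * (sampleLaw P₀ n).real A)
    (hsep : d₀ + d₁ < |mean P₁ - mean P₀|) : 1 - δ₁ - γ ≤ K * δ₀ := by
  set A := {x | |E x - mean P₁| ≤ d₁} with hA
  have hAm : MeasurableSet A := measurableSet_le (by fun_prop) measurable_const
  have r₀ : (sampleLaw P₀ n).real {x | d₀ < |E x - mean P₀|} ≤ δ₀ :=
    ENNReal.toReal_le_of_le_ofReal hδ₀ h₀
  have r₁ : (sampleLaw P₁ n).real {x | d₁ < |E x - mean P₁|} ≤ δ₁ :=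
    ENNReal.toReal_le_of_le_ofReal hδ₁ h₁
  have hsub : A ⊆ {x | d₀ < |E x - mean P₀|} := by
    intro x hx
    have hx' : |E x - mean P₁| ≤ d₁ := hx
    have := abs_sub_le (mean P₁) (E x) (mean P₀)
    rw [abs_sub_comm (mean P₁) (E x)] at this
    change d₀ < |E x - mean P₀|
    linarith
  have hcov : (Set.univ : Set (Fin n → ℝ)) ⊆ {x | d₁ < |E x - mean P₁|} ∪ (Gᶜ ∪ A ∩ G) := by
    intro x _
    by_cases h1 : |E x - mean P₁| ≤ d₁
    · by_cases h2 : x ∈ G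
      · exact Or.inr (Or.inr ⟨h1, h2⟩)
      · exact Or.inr (Or.inl h2)
    · exact Or.inl (not_le.1 h1)
  have h1 : (1 : ℝ) ≤ _ := probReal_univ.symm.le.trans
    ((measureReal_mono (μ := sampleLaw P₁ n) hcov).trans ((measureReal_union_le _ _).trans
      (add_le_add_right (measureReal_union_le _ _) _)))
  have h2 := (hK A hAm).trans (mul_le_mul_of_nonneg_left ((measureReal_mono hsub).trans r₀) hK0)
  linarith

/-! ### Poisson laws and multiple-`δ` estimators -/

section Poisson

open scoped NNReal

/-- The Poisson distribution on the real line. -/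
noncomputable def poissonReal (r : ℝ≥0) : ProbabilityMeasure ℝ :=
  ⟨(poissonMeasure r).map (Nat.cast : ℕ → ℝ), inferInstance⟩

/-- The Stein–Chen identity `E (X f X) = r E f (X + 1)` for the Poisson law. -/
theorem hasSum_poisson_mul {r : ℝ≥0} {f : ℕ → ℝ} {S : ℝ}
    (h : HasSum (fun n : ℕ => Real.exp (-r) * (r : ℝ) ^ n / n.factorial * f (n + 1)) S) :
    HasSum (fun n : ℕ => Real.exp (-r) * (r : ℝ) ^ n / n.factorial * (n * f n)) (r * S) := by
  rw [← hasSum_nat_add_iff' 1]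
  simp only [Finset.range_one, Finset.sum_singleton, Nat.cast_zero, zero_mul, mul_zero, sub_zero]
  refine Eq.subst (motive := fun g => HasSum g (r * S)) (funext fun n => ?_) (h.mul_left (r : ℝ))
  rw [Nat.factorial_succ]
  have : (n.factorial : ℝ) ≠ 0 := by positivity
  push_cast
  field_simp
  ring

theorem hasSum_poisson_moments (r : ℝ≥0) :
    HasSum (fun n : ℕ => Real.exp (-r) * (r : ℝ) ^ n / n.factorial * n) r ∧
    HasSum (fun n : ℕ => Real.exp (-r) * (r : ℝ) ^ n / n.factorial * (n : ℝ) ^ 2) (r ^ 2 + r) ∧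
    HasSum (fun n : ℕ => Real.exp (-r) * (r : ℝ) ^ n / n.factorial * ((n : ℝ) - r) ^ 2) r ∧
    HasSum (fun n : ℕ => Real.exp (-r) * (r : ℝ) ^ n / n.factorial * ((n : ℝ) - r) ^ 4)
      (3 * r ^ 2 + r) := by
  have m0 : HasSum (fun n : ℕ => Real.exp (-r) * (r : ℝ) ^ n / n.factorial) 1 :=
    hasSum_one_poissonMeasure r
  obtain ⟨w, hw⟩ : ∃ w : ℕ → ℝ, ∀ n : ℕ, Real.exp (-r) * (r : ℝ) ^ n / n.factorial = w n :=
    ⟨_, fun _ => rfl⟩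
  have step : ∀ (f : ℕ → ℝ) (S : ℝ), HasSum (fun n => w n * f (n + 1)) S →
      HasSum (fun n => w n * (n * f n)) (r * S) := fun f S h => by
    simp only [← hw] at h ⊢
    exact hasSum_poisson_mul h
  simp only [hw] at m0 ⊢
  have cg : ∀ {f g : ℕ → ℝ} {S T : ℝ}, HasSum f S → (∀ n, f n = g n) → S = T → HasSum g T := by
    rintro f g S T h e rfl
    rwa [← funext e]
  have m1 : HasSum (fun n : ℕ => w n * n) r :=
    cg (step (fun _ => 1) 1 (by simpa using m0)) (fun n => by ring) (by ring)
  have m2 : HasSum (fun n : ℕ => w n * (n : ℝ) ^ 2) (r ^ 2 + r) :=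
    cg (step (fun n => n) (r + 1) (cg (m1.add m0) (fun n => by push_cast; ring) rfl))
      (fun n => by ring) (by ring)
  have m3 : HasSum (fun n : ℕ => w n * (n : ℝ) ^ 3) (r ^ 3 + 3 * r ^ 2 + r) :=
    cg (step (fun n => (n : ℝ) ^ 2) _
      (cg ((m2.add (m1.mul_left 2)).add m0) (fun n => by push_cast; ring) rfl))
      (fun n => by ring) (by ring)
  have m4 : HasSum (fun n : ℕ => w n * (n : ℝ) ^ 4) (r ^ 4 + 6 * r ^ 3 + 7 * r ^ 2 + r) :=
    cg (step (fun n => (n : ℝ) ^ 3) _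
      (cg (((m3.add (m2.mul_left 3)).add (m1.mul_left 3)).add m0)
        (fun n => by push_cast; ring) rfl))
      (fun n => by ring) (by ring)
  refine ⟨m1, m2, ?_, ?_⟩
  · exact cg ((m2.add (m1.mul_left (-2 * (r : ℝ)))).add (m0.mul_left ((r : ℝ) ^ 2)))
      (fun n => by ring) (by ring)
  · exact cg ((((m4.add (m3.mul_left (-4 * (r : ℝ)))).add (m2.mul_left (6 * (r : ℝ) ^ 2))).add
      (m1.mul_left (-4 * (r : ℝ) ^ 3))).add (m0.mul_left ((r : ℝ) ^ 4)))
      (fun n => by ring) (by ring)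

theorem integral_poissonReal {r : ℝ≥0} {f : ℝ → ℝ} {S : ℝ} (hf : Measurable f)
    (h0 : ∀ n : ℕ, 0 ≤ f n)
    (h : HasSum (fun n : ℕ => Real.exp (-r) * (r : ℝ) ^ n / n.factorial * f n) S) :
    Integrable f (poissonReal r : Measure ℝ) ∧ ∫ x, f x ∂(poissonReal r : Measure ℝ) = S := by
  have hi : Integrable (fun n : ℕ => f n) (poissonMeasure r) := by
    rw [integrable_poissonMeasure_iff]
    convert h.summable using 1
    ext n
    rw [Real.norm_of_nonneg (h0 n)]
  change Integrable f ((poissonMeasure r).map (Nat.cast : ℕ → ℝ)) ∧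
    ∫ x, f x ∂((poissonMeasure r).map (Nat.cast : ℕ → ℝ)) = S
  refine ⟨(integrable_map_measure hf.aestronglyMeasurable (by fun_prop)).2 hi, ?_⟩
  rw [integral_map (by fun_prop) hf.aestronglyMeasurable]
  exact (hasSum_integral_poissonMeasure hi).unique h

theorem poissonReal_moments (r : ℝ≥0) : MemLp id 2 (poissonReal r : Measure ℝ) ∧
    mean (poissonReal r) = r ∧ stdDev (poissonReal r) = √r ∧
    Integrable (fun x => (x - mean (poissonReal r)) ^ 4) (poissonReal r : Measure ℝ) ∧
    ∫ x, (x - mean (poissonReal r)) ^ 4 ∂(poissonReal r : Measure ℝ) = 3 * r ^ 2 + r := by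
  obtain ⟨h1, h2, hv, h4⟩ := hasSum_poisson_moments r
  have hmean : mean (poissonReal r) = r :=
    (integral_poissonReal (f := fun x => max x 0) (by fun_prop) (fun n => le_max_right _ _)
      (by simpa using h1)) |>.2 ▸ by
      rw [mean]
      change ∫ x, x ∂((poissonMeasure r).map (Nat.cast : ℕ → ℝ)) =
        ∫ x, max x 0 ∂((poissonMeasure r).map (Nat.cast : ℕ → ℝ))
      rw [integral_map (by fun_prop) (by fun_prop), integral_map (by fun_prop) (by fun_prop)]
      simp
  have hL2 : MemLp id 2 (poissonReal r : Measure ℝ) :=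
    (memLp_two_iff_integrable_sq (by fun_prop)).2
      (integral_poissonReal (f := fun x => x ^ 2) (by fun_prop) (fun n => by positivity) h2).1
  rw [hmean]
  obtain ⟨i4, e4⟩ := integral_poissonReal (f := fun x => (x - r) ^ 4) (by fun_prop)
    (fun n => by positivity) h4
  refine ⟨hL2, rfl, ?_, i4, e4⟩
  have hs := integral_sub_mean_sq (P := poissonReal r)
  rw [hmean, (integral_poissonReal (f := fun x => (x - r) ^ 2) (by fun_prop)
    (fun n => by positivity) hv).2] at hs
  rw [hs, Real.sqrt_sq (stdDev_nonneg _)]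

theorem poissonReal_mem_momentClass {α η : ℝ} (hα : 2 < α ∧ α ≤ 3) (hη : 0 < η) {r : ℝ≥0}
    (hr : 0 < r) (h : 3 + 1 / (r : ℝ) ≤ η ^ (2 * α / (α - 2))) :
    poissonReal r ∈ momentClass α η := by
  obtain ⟨h2, hm, hs, hi, h4⟩ := poissonReal_moments r
  have hr' : (0 : ℝ) < r := hr
  refine mem_momentClass_of_kurtosis_le hα hη h2 (by rw [hs]; exact Real.sqrt_pos.2 hr')
    (by positivity) hi (le_of_eq ?_) h
  rw [h4, hs, show √(r : ℝ) ^ 4 = (√(r : ℝ) ^ 2) ^ 2 by ring, Real.sq_sqrt hr'.le]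
  field_simp

theorem sampleLaw_poissonReal (r : ℝ≥0) (n : ℕ) :
    sampleLaw (poissonReal r) n =
      (Measure.pi fun _ : Fin n => poissonMeasure r).map fun x i => (x i : ℝ) := by
  rw [sampleLaw, Measure.pi_map_pi (μ := fun _ : Fin n => poissonMeasure r)
    (f := fun _ => (Nat.cast : ℕ → ℝ)) fun i => by fun_prop]
  rfl

/-- The likelihood ratio of two Poisson samples is `e ^ (-n (r₁ - r₀)) (r₁ / r₀) ^ (∑ xᵢ)`. -/
theorem sampleLaw_poissonReal_inter_le {r₀ r₁ : ℝ≥0} (h₀ : 0 < r₀) (h : r₀ ≤ r₁) (n : ℕ) (s : ℝ)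
    {A : Set (Fin n → ℝ)} (hA : MeasurableSet A) :
    (sampleLaw (poissonReal r₁) n).real (A ∩ {x | ∑ i, x i ≤ s}) ≤
      ((r₁ : ℝ) / r₀) ^ s * (sampleLaw (poissonReal r₀) n).real A := by
  have h₀' : (0 : ℝ) < r₀ := h₀
  have h' : (r₀ : ℝ) ≤ r₁ := h
  have hratio : 1 ≤ (r₁ : ℝ) / r₀ := by rwa [one_le_div h₀']
  set u : ℝ := (r₁ : ℝ) / r₀ with hu
  have hu0 : 0 < u := by linarith
  set cast : (Fin n → ℕ) → (Fin n → ℝ) := fun x i => (x i : ℝ) with hcast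
  have hcm : Measurable cast := by fun_prop
  have hG : MeasurableSet {x : Fin n → ℝ | ∑ i, x i ≤ s} :=
    measurableSet_le (by fun_prop) measurable_const
  have key : (sampleLaw (poissonReal r₁) n) (A ∩ {x | ∑ i, x i ≤ s}) ≤
      ENNReal.ofReal (u ^ s) * (sampleLaw (poissonReal r₀) n) A := by
    rw [sampleLaw_poissonReal, sampleLaw_poissonReal, Measure.map_apply hcm (hA.inter hG),
      Measure.map_apply hcm hA,
      ← Measure.tsum_indicator_apply_singleton _ _ (hcm (hA.inter hG)),
      ← Measure.tsum_indicator_apply_singleton _ _ (hcm hA), ← ENNReal.tsum_mul_left]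
    refine ENNReal.tsum_le_tsum fun x => ?_
    by_cases hx : x ∈ cast ⁻¹' (A ∩ {x | ∑ i, x i ≤ s})
    · rw [Set.indicator_of_mem hx, Set.indicator_of_mem (show x ∈ cast ⁻¹' A from hx.1)]
      simp only [Measure.pi_singleton, poissonMeasure_singleton]
      rw [← ENNReal.ofReal_prod_of_nonneg (fun i _ => by positivity),
        ← ENNReal.ofReal_prod_of_nonneg (fun i _ => by positivity),
        ← ENNReal.ofReal_mul (by positivity)]
      apply ENNReal.ofReal_le_ofReal
      have hxs : ∑ i, (x i : ℝ) ≤ s := hx.2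
      calc ∏ i, Real.exp (-r₁) * (r₁ : ℝ) ^ x i / (x i).factorial
          ≤ ∏ i, u ^ (x i : ℝ) * (Real.exp (-r₀) * (r₀ : ℝ) ^ x i / (x i).factorial) := by
            refine Finset.prod_le_prod (fun i _ => by positivity) fun i _ => ?_
            rw [Real.rpow_natCast, hu, div_pow]
            have e : (r₁ : ℝ) ^ x i / (r₀ : ℝ) ^ x i *
                (Real.exp (-r₀) * (r₀ : ℝ) ^ x i / (x i).factorial) =
                Real.exp (-r₀) * (r₁ : ℝ) ^ x i / (x i).factorial := by
              field_simp
            rw [e]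
            gcongr
        _ = u ^ (∑ i, (x i : ℝ)) *
            ∏ i, Real.exp (-r₀) * (r₀ : ℝ) ^ x i / (x i).factorial := by
            rw [Finset.prod_mul_distrib, Real.rpow_sum_of_pos hu0]
        _ ≤ _ := by
            gcongr
    · rw [Set.indicator_of_notMem hx]; exact zero_le
  rw [measureReal_def, measureReal_def, ← ENNReal.toReal_ofReal (show 0 ≤ u ^ s by positivity),
    ← ENNReal.toReal_mul]
  exact ENNReal.toReal_mono (ENNReal.mul_ne_top ENNReal.ofReal_ne_top (measure_ne_top _ _)) key

theorem sampleLaw_poissonReal_sum_gt_le {r : ℝ≥0} (hr : 0 < r) {n : ℕ} (hn : 0 < n) :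
    (sampleLaw (poissonReal r) n).real {x | ∑ i, x i ≤ 4 * (n * r)}ᶜ ≤ 1 / 4 := by
  obtain ⟨h2, hm, -, -, -⟩ := poissonReal_moments r
  have hr' : (0 : ℝ) < r := hr
  have hn' : (0 : ℝ) < n := by exact_mod_cast hn
  have hi : ∀ i : Fin n, Integrable (fun x : Fin n → ℝ => x i) (sampleLaw (poissonReal r) n) :=
    fun i => (h2.comp_measurePreserving
      (measurePreserving_eval (fun _ => (poissonReal r : Measure ℝ)) i)).integrable one_le_two
  have he : ∀ i : Fin n, ∫ x : Fin n → ℝ, x i ∂(sampleLaw (poissonReal r) n) = r := fun i => by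
    rw [← hm]
    exact integral_comp_eval (μ := fun _ => (poissonReal r : Measure ℝ)) (f := fun x => x)
      (by fun_prop)
  have hnn : 0 ≤ᵐ[sampleLaw (poissonReal r) n] fun x => ∑ i, x i := by
    rw [sampleLaw_poissonReal]
    refine (ae_map_iff (measurable_pi_lambda _ fun i => by fun_prop).aemeasurable
      (measurableSet_le measurable_const (by fun_prop))).2
      (ae_of_all _ fun x => ?_)
    exact Finset.sum_nonneg fun i _ => Nat.cast_nonneg _
  have := mul_meas_ge_le_integral_of_nonneg hnn (integrable_finsetSum _ fun i _ => hi i)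
    (4 * (n * r))
  rw [integral_finsetSum _ fun i _ => hi i] at this
  simp only [he, Finset.sum_const, Finset.card_univ, Fintype.card_fin, nsmul_eq_mul] at this
  have hle : (sampleLaw (poissonReal r) n).real {x | ∑ i, x i ≤ 4 * (n * r)}ᶜ ≤
      (sampleLaw (poissonReal r) n).real {x | 4 * (n * r) ≤ ∑ i, x i} :=
    measureReal_mono fun x hx => (not_le.1 (show ¬ ∑ i, x i ≤ 4 * (n * r) from hx)).le
  have hpos : (0 : ℝ) < n * r := by positivity
  refine hle.trans ?_
  by_contra hcon
  rw [not_le] at hcon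
  nlinarith

/-- A lower bound for all multiple-`δ` estimators from two Poisson laws with parameters `r` and
`u r`: an estimator that is accurate under the second law at a fixed confidence level makes an
error of `(u - 1) r` under the first law with probability at least `e ^ (-O(n r u log u))`, more
than a sub-Gaussian tail allows if `u` is large. -/
theorem not_isMultipleDelta_of_poisson {L u x δmin : ℝ} (hL : √2 ≤ L) (hu : 2 ≤ u)
    (hx : x = (u - 1) ^ 2 / (4 * L ^ 2)) (hux : 4 * u * Real.log u + 1 ≤ x) {r v : ℝ≥0}
    (hv : (v : ℝ) = u * r) {n : ℕ} (hnr : 48 * L ^ 2 ≤ n * r)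
    (hδ : δmin ≤ Real.exp (1 - x * (n * r))) {Ps : Set (ProbabilityMeasure ℝ)}
    (hr : poissonReal r ∈ Ps) (hvP : poissonReal v ∈ Ps) (E : (Fin n → ℝ) → ℝ) :
    ¬ IsMultipleDelta L Ps n δmin E := by
  rintro ⟨hE, hP⟩
  have hL2 : 2 ≤ L ^ 2 := by
    have := pow_le_pow_left₀ (Real.sqrt_nonneg 2) hL 2
    rwa [Real.sq_sqrt (by norm_num)] at this
  have hL0 : 0 < L := (Real.sqrt_pos.2 (by norm_num)).trans_le hL
  set N : ℝ := n * r with hN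
  have hN96 : 96 ≤ N := by linarith
  have hn0 : 0 < n := by
    rcases Nat.eq_zero_or_pos n with h | h
    · rw [hN, h] at hN96; norm_num at hN96
    · exact h
  have hn' : (0 : ℝ) < n := by exact_mod_cast hn0
  have hr0 : (0 : ℝ) < r := by
    by_contra h
    have : (r : ℝ) = 0 := le_antisymm (not_lt.1 h) r.2
    rw [hN, this] at hN96; norm_num at hN96
  have hv0 : (0 : ℝ) < v := by rw [hv]; positivity
  have hlog : 0 ≤ Real.log u := Real.log_nonneg (by linarith)
  have hx1 : 1 ≤ x := by
    have : 0 ≤ 4 * u * Real.log u := by positivity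
    linarith
  have hxN : N ≤ x * N := le_mul_of_one_le_left (by linarith) hx1
  have hsmall : Real.exp (1 - x * N) ≤ 1 / 4 := by
    have h1 : Real.exp (1 - x * N) ≤ Real.exp (-95) := Real.exp_le_exp.2 (by linarith)
    have h2 : (95 : ℝ) + 1 ≤ Real.exp 95 := Real.add_one_le_exp 95
    rw [Real.exp_neg] at h1
    refine h1.trans ?_
    rw [one_div]
    exact inv_anti₀ (by norm_num) (by linarith)
  obtain ⟨-, hmr, hsr, -, -⟩ := poissonReal_moments r
  obtain ⟨-, hmv, hsv, -, -⟩ := poissonReal_moments v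
  have h₀ := hP _ hr (Real.exp (1 - x * N)) ⟨hδ, by linarith⟩
  have h₁ := hP _ hvP (1 / 4) ⟨hδ.trans hsmall, by norm_num⟩
  -- the two deviations are at most half of the distance of the two means
  have d₀ : deviation L (poissonReal r) n (Real.exp (1 - x * N)) = (u - 1) / 2 * r := by
    rw [deviation, hsr, one_div, ← Real.exp_neg, Real.log_exp, mul_assoc, ← Real.sqrt_mul hr0.le]
    have : (r : ℝ) * ((1 + -(1 - x * N)) / n) = ((u - 1) / (2 * L) * r) ^ 2 := by
      rw [hx, hN]; field_simp; ring
    rw [this, Real.sqrt_sq (by have : 0 ≤ u - 1 := by linarith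
                               positivity)]
    field_simp
  have d₁ : deviation L (poissonReal v) n (1 / 4) < (u - 1) / 2 * r := by
    have hl4 : Real.log (1 / (1 / 4)) < 2 := by
      rw [Real.log_lt_iff_lt_exp (by norm_num)]
      have := Real.quadratic_le_exp_of_nonneg (x := 2) (by norm_num)
      norm_num at this ⊢
      linarith
    have hpos : 0 < (u - 1) / 2 * (r : ℝ) := mul_pos (by linarith) hr0
    rw [deviation, hsv, mul_assoc, ← Real.sqrt_mul hv0.le, ← lt_div_iff₀' hL0,
      Real.sqrt_lt' (by positivity), ← mul_div_assoc, div_lt_iff₀ hn', hv]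
    have h1 : u * r * (1 + Real.log (1 / (1 / 4))) < u * r * 3 := by
      have : 0 < u * r := by positivity
      exact mul_lt_mul_of_pos_left (by linarith) this
    refine h1.trans_le ?_
    have e : ((u - 1) / 2 * r / L) ^ 2 * n = (u - 1) ^ 2 * r * (N / (4 * L ^ 2)) := by
      rw [hN]; field_simp; ring
    rw [e]
    have h2 : 12 ≤ N / (4 * L ^ 2) := by rw [le_div_iff₀ (by positivity)]; linarith
    have h3 : u * 3 ≤ (u - 1) ^ 2 * 12 := by nlinarith
    calc u * r * 3 = u * 3 * r := by ring
      _ ≤ (u - 1) ^ 2 * 12 * r := by gcongr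
      _ = (u - 1) ^ 2 * r * 12 := by ring
      _ ≤ _ := by gcongr
  have hsep : deviation L (poissonReal r) n (Real.exp (1 - x * N)) +
      deviation L (poissonReal v) n (1 / 4) < |mean (poissonReal v) - mean (poissonReal r)| := by
    rw [hmr, hmv, hv]
    refine lt_of_lt_of_le ?_ (le_abs_self _)
    rw [d₀]
    linarith
  have hrv : r ≤ v := by
    rw [← NNReal.coe_le_coe, hv]
    exact le_mul_of_one_le_left hr0.le (by linarith)
  have huv : (v : ℝ) / r = u := by rw [hv]; field_simp
  have htwo := two_point_le hE (Real.exp_pos _).le (by norm_num)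
    (K := ((v : ℝ) / r) ^ (4 * (n * v) : ℝ)) (by positivity) h₀ h₁
    (sampleLaw_poissonReal_sum_gt_le (by exact_mod_cast hv0) hn0)
    (fun A hA => sampleLaw_poissonReal_inter_le (by exact_mod_cast hr0) hrv n _ hA) hsep
  rw [huv, Real.rpow_def_of_pos (by linarith), ← Real.exp_add] at htwo
  have hexp : Real.log u * (4 * (n * v)) + (1 - x * N) ≤ 1 - N := by
    have e : Real.log u * (4 * (n * v)) = 4 * u * Real.log u * N := by rw [hv, hN]; ring
    rw [e]
    nlinarith
  have h1 : Real.exp (Real.log u * (4 * (n * v)) + (1 - x * N)) ≤ Real.exp (-95) :=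
    Real.exp_le_exp.2 (by linarith)
  have h2 : (95 : ℝ) + 1 ≤ Real.exp 95 := Real.add_one_le_exp 95
  rw [Real.exp_neg (95 : ℝ)] at h1
  have h3 : (Real.exp 95)⁻¹ ≤ 96⁻¹ := inv_anti₀ (by norm_num) (by linarith)
  norm_num at htwo h3
  linarith

/-- For a large ratio `u`, the exponent `u² / L²` of a sub-Gaussian tail exceeds the exponent
`u log u` of a Poisson tail. -/
theorem exists_ratio {L : ℝ} (hL : √2 ≤ L) :
    ∃ u : ℝ, 2 ≤ u ∧ 4 * u * Real.log u + 1 ≤ (u - 1) ^ 2 / (4 * L ^ 2) := by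
  have hL2 : 2 ≤ L ^ 2 := by
    have := pow_le_pow_left₀ (Real.sqrt_nonneg 2) hL 2
    rwa [Real.sq_sqrt (by norm_num)] at this
  set w : ℝ := 144 * L ^ 2 with hw
  have hw1 : 288 ≤ w := by linarith
  have hlog : Real.log (w ^ 2) ≤ 2 * w := by
    rw [Real.log_pow]
    have := Real.log_le_sub_one_of_pos (show 0 < w by linarith)
    push_cast
    linarith
  refine ⟨w ^ 2, by nlinarith, ?_⟩
  rw [le_div_iff₀ (by positivity)]
  have h1 : 4 * w ^ 2 * Real.log (w ^ 2) + 1 ≤ 8 * w ^ 3 + 1 := by nlinarith [sq_nonneg w]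
  have e : 4 * L ^ 2 = w / 36 := by rw [hw]; ring
  rw [e]
  calc (4 * w ^ 2 * Real.log (w ^ 2) + 1) * (w / 36) ≤ (8 * w ^ 3 + 1) * (w / 36) := by gcongr
    _ ≤ (w ^ 2 - 1) ^ 2 := by
      have h4 : 0 ≤ w ^ 3 := by positivity
      nlinarith [sq_nonneg w, sq_nonneg (w ^ 2), mul_nonneg h4 (show 0 ≤ w by linarith)]

theorem exists_not_isMultipleDelta {α : ℝ} (hα : 2 < α ∧ α ≤ 3) {C : ℝ} (hC : 0 < C) {L : ℝ}
    (hL : √2 ≤ L) : ∃ n₀ : ℕ, ∃ c : ℝ, 0 < c ∧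
      ∀ η : ℝ, (3 : ℝ) ^ (1 / 3 : ℝ) * (2 : ℝ) ^ (1 / 6 : ℝ) ≤ η →
        ∀ n : ℕ, n₀ * kAlpha C α η ≤ n →
          ¬ ∃ E : (Fin n → ℝ) → ℝ,
            IsMultipleDelta L (momentClass α η) n
              (Real.exp (1 - c * n / (kAlpha C α η : ℝ))) E := by
  obtain ⟨u, hu, hux⟩ := exists_ratio hL
  set x := (u - 1) ^ 2 / (4 * L ^ 2) with hx
  have hlog : 0 ≤ Real.log u := Real.log_nonneg (by linarith)
  have hx1 : 1 ≤ x := by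
    have : 0 ≤ 4 * u * Real.log u := by positivity
    linarith
  refine ⟨⌈24 * L ^ 2 / C⌉₊, 2 * (C + 1) * x, by positivity, fun η hη n hn => ?_⟩
  rintro ⟨E, hE⟩
  obtain ⟨hη1, hq18⟩ := eighteen_le_rpow hα hη
  set q := η ^ (2 * α / (α - 2)) with hq
  have hq0 : 0 < q := by linarith
  set k := kAlpha C α η with hk
  have hk1 : C * q ≤ k := Nat.le_ceil _
  have hk2 : (k : ℝ) ≤ (C + 1) * q := by
    have := (Nat.ceil_lt_add_one (show 0 ≤ C * q by positivity)).le
    rw [hk, kAlpha, ← hq]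
    linarith
  have hk0 : (0 : ℝ) < k := lt_of_lt_of_le (by positivity) hk1
  -- the Poisson parameter is the smallest one that the class allows, up to a constant
  set r : ℝ≥0 := (2 / q).toNNReal with hr
  set v : ℝ≥0 := (u * (2 / q)).toNNReal with hv
  have hrr : (r : ℝ) = 2 / q := Real.coe_toNNReal _ (by positivity)
  have hvv : (v : ℝ) = u * (2 / q) := Real.coe_toNNReal _ (by positivity)
  have hn' : 24 * L ^ 2 * q ≤ n := by
    have h1 := Nat.le_ceil (24 * L ^ 2 / C)
    have h2 : ((⌈24 * L ^ 2 / C⌉₊ : ℕ) : ℝ) * k ≤ n := by exact_mod_cast hn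
    calc 24 * L ^ 2 * q = 24 * L ^ 2 / C * (C * q) := by field_simp
      _ ≤ (⌈24 * L ^ 2 / C⌉₊ : ℝ) * (k : ℝ) := by gcongr
      _ ≤ n := h2
  have hmem : ∀ t : ℝ≥0, 2 / q ≤ (t : ℝ) → poissonReal t ∈ momentClass α η := by
    intro t ht
    have h0 : 0 < 2 / q := by positivity
    refine poissonReal_mem_momentClass hα (by linarith) (by exact_mod_cast h0.trans_le ht) ?_
    have : 1 / (t : ℝ) ≤ q / 2 := by
      rw [one_div, ← inv_div]
      exact inv_anti₀ h0 ht
    rw [← hq]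
    linarith
  refine not_isMultipleDelta_of_poisson hL hu hx hux (r := r) (v := v) (by rw [hvv, hrr]) ?_ ?_
    (hmem r hrr.ge) (hmem v ?_) E hE
  · rw [hrr, ← mul_div_assoc, le_div_iff₀ hq0]
    linarith
  · apply Real.exp_le_exp.2
    have : x * (n * r) ≤ 2 * (C + 1) * x * n / k := by
      rw [le_div_iff₀ hk0, hrr]
      calc x * (n * (2 / q)) * k ≤ x * (n * (2 / q)) * ((C + 1) * q) := by gcongr
        _ = 2 * (C + 1) * x * n := by field_simp
    linarith
  · rw [hvv]
    exact le_mul_of_one_le_left (by positivity) (by linarith)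

end Poisson

/-! ### Contaminated laws and `δ`-dependent estimators -/

theorem pi_le_pow_smul_pi {n : ℕ} {μ ν : Measure ℝ} [IsProbabilityMeasure μ]
    [IsProbabilityMeasure ν] {c : ENNReal} (h : ∀ s, c * μ s ≤ ν s)
    {A : Set (Fin n → ℝ)} (hA : MeasurableSet A) :
    c ^ n * Measure.pi (fun _ : Fin n => μ) A ≤ Measure.pi (fun _ : Fin n => ν) A := by
  have key : (c ^ n) • (Measure.pi fun _ : Fin n => μ).toOuterMeasure ≤
      OuterMeasure.pi fun _ : Fin n => ν.toOuterMeasure := by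
    rw [OuterMeasure.le_pi]
    intro s _
    have : ∀ t, ((c ^ n) • (Measure.pi fun _ : Fin n => μ).toOuterMeasure) t =
      c ^ n * Measure.pi (fun _ : Fin n => μ) t := fun t => rfl
    rw [this, Measure.pi_pi]
    calc c ^ n * ∏ i, μ (s i) = ∏ i, c * μ (s i) := by simp [Finset.prod_mul_distrib]
      _ ≤ ∏ i, ν (s i) := Finset.prod_le_prod' fun i _ => h (s i)
  have e : Measure.pi (fun _ : Fin n => ν) A =
      OuterMeasure.pi (fun _ : Fin n => ν.toOuterMeasure) A := by
    rw [Measure.pi, toMeasure_apply _ _ hA]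
  rw [e]
  exact key A

/-- The symmetric two-point law `(δ_{b - 1} + δ_{b + 1}) / 2`. -/
noncomputable def coinMeasure (b : ℝ) : Measure ℝ :=
  ENNReal.ofReal (1 / 2) • Measure.dirac (b - 1) + ENNReal.ofReal (1 / 2) • Measure.dirac (b + 1)

instance coinMeasure.instIsProbabilityMeasure (b : ℝ) : IsProbabilityMeasure (coinMeasure b) := by
  constructor
  simp only [coinMeasure, Measure.add_apply, Measure.smul_apply, measure_univ, smul_eq_mul, mul_one]
  rw [← ENNReal.ofReal_add (by norm_num) (by norm_num)]
  norm_num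

theorem integrable_coinMeasure (b : ℝ) (f : ℝ → ℝ) : Integrable f (coinMeasure b) :=
  ((integrable_dirac (by simp)).smul_measure ENNReal.ofReal_ne_top).add_measure
    ((integrable_dirac (by simp)).smul_measure ENNReal.ofReal_ne_top)

theorem integral_coinMeasure (b : ℝ) (f : ℝ → ℝ) :
    ∫ x, f x ∂(coinMeasure b) = (f (b - 1) + f (b + 1)) / 2 := by
  rw [coinMeasure, integral_add_measure
    ((integrable_dirac (by simp)).smul_measure ENNReal.ofReal_ne_top)
    ((integrable_dirac (by simp)).smul_measure ENNReal.ofReal_ne_top), integral_smul_measure,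
    integral_smul_measure, integral_dirac, integral_dirac, ENNReal.toReal_ofReal (by norm_num)]
  simp only [smul_eq_mul]
  ring

/-- The law of `U + ξ`, where `U` is a random sign and, independently, `ξ` equals `a` or `-a` with
probability `p` each, and vanishes otherwise. -/
noncomputable def contaminatedMeasure (p a : ℝ) : Measure ℝ :=
  ENNReal.ofReal (1 - 2 * p) • coinMeasure 0 +
    (ENNReal.ofReal p • coinMeasure a + ENNReal.ofReal p • coinMeasure (-a))

theorem isProbabilityMeasure_contaminatedMeasure {p : ℝ} (hp0 : 0 ≤ p) (hp : p ≤ 1 / 2) (a : ℝ) :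
    IsProbabilityMeasure (contaminatedMeasure p a) := by
  constructor
  simp only [contaminatedMeasure, Measure.add_apply, Measure.smul_apply, measure_univ, smul_eq_mul,
    mul_one]
  rw [← ENNReal.ofReal_add hp0 hp0, ← ENNReal.ofReal_add (by linarith) (by linarith)]
  ring_nf
  simp

theorem integral_contaminatedMeasure {p : ℝ} (hp0 : 0 ≤ p) (hp : p ≤ 1 / 2) (a : ℝ) (f : ℝ → ℝ) :
    Integrable f (contaminatedMeasure p a) ∧ ∫ x, f x ∂(contaminatedMeasure p a) =
      (1 - 2 * p) * ((f (-1) + f 1) / 2) +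
        p * ((f (a - 1) + f (a + 1)) / 2 + (f (-a - 1) + f (-a + 1)) / 2) := by
  have i : ∀ (c b : ℝ), Integrable f (ENNReal.ofReal c • coinMeasure b) := fun c b =>
    (integrable_coinMeasure b f).smul_measure ENNReal.ofReal_ne_top
  refine ⟨(i _ _).add_measure ((i _ _).add_measure (i _ _)), ?_⟩
  rw [contaminatedMeasure, integral_add_measure (i _ _) ((i _ _).add_measure (i _ _)),
    integral_add_measure (i _ _) (i _ _)]
  simp only [integral_smul_measure, integral_coinMeasure, smul_eq_mul]
  rw [ENNReal.toReal_ofReal (by linarith), ENNReal.toReal_ofReal hp0]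
  simp only [zero_sub, zero_add]
  ring

theorem pow_mul_exp_bound {y : ℝ} (hy : 10 ≤ y) : 3 * y ^ 4 ≤ 8 * Real.exp y := by
  have h1 : Real.exp y = Real.exp (y / 4) ^ 4 := by
    rw [← Real.exp_nat_mul]; congr 1; push_cast; ring
  have h2 : (4 / 5) * y ≤ Real.exp (y / 4) := by
    have e : Real.exp (y / 4) = Real.exp (y / 4 - 5 / 2) * (Real.exp (1 / 2)) ^ 5 := by
      rw [← Real.exp_nat_mul, ← Real.exp_add]; congr 1; push_cast; ring
    have h3 : y / 4 - 5 / 2 + 1 ≤ Real.exp (y / 4 - 5 / 2) := Real.add_one_le_exp _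
    have h4 : (13 / 8 : ℝ) ≤ Real.exp (1 / 2) := by
      have := Real.quadratic_le_exp_of_nonneg (x := 1 / 2) (by norm_num)
      norm_num at this ⊢
      linarith
    have h5 : (8 : ℝ) ≤ Real.exp (1 / 2) ^ 5 :=
      le_trans (by norm_num) (pow_le_pow_left₀ (by norm_num) h4 5)
    rw [e]
    calc 4 / 5 * y ≤ (y / 4 - 5 / 2 + 1) * 8 := by linarith
      _ ≤ _ := by gcongr
  rw [h1]
  have := pow_le_pow_left₀ (by linarith) h2 4
  have h6 : 0 ≤ y ^ 4 := by positivity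
  nlinarith

/-- No estimator is sub-Gaussian at a confidence level exponentially small in the sample size: a
rare but distant cluster of the contaminated law produces a sample that is typical of another law
with a distant mean, with a probability that decays too slowly. -/
theorem not_isDeltaDependent {α η : ℝ} (hα : 2 < α ∧ α ≤ 3)
    (hη : (3 : ℝ) ^ (1 / 3 : ℝ) * (2 : ℝ) ^ (1 / 6 : ℝ) ≤ η) {L : ℝ} (hL : √2 ≤ L) {n : ℕ}
    (hn : 0 < n) {δ : ℝ} (hδ : δ = Real.exp (1 - 5 * L ^ 2 * n))
    (E : (Fin n → ℝ) × Set.Ico δ 1 → ℝ) : ¬ IsDeltaDependent L (momentClass α η) n δ E := by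
  rintro ⟨hE, hP⟩
  obtain ⟨hη1, hq18⟩ := eighteen_le_rpow hα hη
  have hL2 : 2 ≤ L ^ 2 := by
    have := pow_le_pow_left₀ (Real.sqrt_nonneg 2) hL 2
    rwa [Real.sq_sqrt (by norm_num)] at this
  have hL0 : 0 < L := (Real.sqrt_pos.2 (by norm_num)).trans_le hL
  set y : ℝ := 5 * L ^ 2 with hy
  have hy10 : 10 ≤ y := by linarith
  have hn' : (1 : ℝ) ≤ n := by exact_mod_cast hn
  have hyn : y ≤ y * n := le_mul_of_one_le_right (by linarith) hn'
  have hδ0 : 0 < δ := by rw [hδ]; exact Real.exp_pos _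
  have hδ50 : δ ≤ 1 / 50 := by
    have h1 : δ ≤ Real.exp (-9) := hδ ▸ Real.exp_le_exp.2 (by linarith)
    have h2 := Real.quadratic_le_exp_of_nonneg (x := 9) (by norm_num)
    rw [Real.exp_neg] at h1
    refine h1.trans ?_
    rw [one_div]
    exact inv_anti₀ (by norm_num) (by linarith)
  -- contamination at distance `y` with the largest weight that keeps the kurtosis below `18`
  set p : ℝ := 8 / y ^ 4 with hp
  have hy4 : (10 : ℝ) ^ 4 ≤ y ^ 4 := pow_le_pow_left₀ (by norm_num) hy10 4
  have hp0 : 0 < p := by positivity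
  have hp1 : p ≤ 1 / 2 := by
    rw [hp, div_le_iff₀ (by positivity)]; linarith
  have hprob := isProbabilityMeasure_contaminatedMeasure hp0.le hp1 y
  let P₀ : ProbabilityMeasure ℝ := ⟨contaminatedMeasure p y, hprob⟩
  let P₁ : ProbabilityMeasure ℝ := ⟨coinMeasure y, inferInstance⟩
  have int₀ : ∀ f : ℝ → ℝ, Integrable f (P₀ : Measure ℝ) ∧ ∫ x, f x ∂(P₀ : Measure ℝ) =
      (1 - 2 * p) * ((f (-1) + f 1) / 2) +
        p * ((f (y - 1) + f (y + 1)) / 2 + (f (-y - 1) + f (-y + 1)) / 2) := fun f =>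
    integral_contaminatedMeasure hp0.le hp1 y f
  have int₁ : ∀ f : ℝ → ℝ, ∫ x, f x ∂(P₁ : Measure ℝ) = (f (y - 1) + f (y + 1)) / 2 :=
    integral_coinMeasure y
  have m₀ : mean P₀ = 0 := by
    rw [mean, (int₀ fun x => x).2]; ring
  have m₁ : mean P₁ = y := by
    rw [mean, int₁ fun x => x]; ring
  have l₀ : MemLp id 2 (P₀ : Measure ℝ) :=
    (memLp_two_iff_integrable_sq (by fun_prop)).2 (int₀ fun x => x ^ 2).1
  have l₁ : MemLp id 2 (P₁ : Measure ℝ) :=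
    (memLp_two_iff_integrable_sq (by fun_prop)).2 (integrable_coinMeasure y fun x => x ^ 2)
  have v₀ : stdDev P₀ ^ 2 = 1 + 16 / y ^ 2 := by
    rw [← integral_sub_mean_sq, m₀, (int₀ fun x => (x - 0) ^ 2).2, hp]
    field_simp
    ring
  have v₁ : stdDev P₁ ^ 2 = 1 := by
    rw [← integral_sub_mean_sq, m₁, int₁ fun x => (x - y) ^ 2]
    ring
  have s₁ : stdDev P₁ = 1 := by
    rw [← Real.sqrt_sq (stdDev_nonneg P₁), v₁, Real.sqrt_one]
  have hy2 : 16 / y ^ 2 ≤ 16 / 100 :=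
    div_le_div_of_nonneg_left (by norm_num) (by norm_num) (by nlinarith)
  have s₀pos : 0 < stdDev P₀ := by
    refine lt_of_le_of_ne (stdDev_nonneg _) fun h => ?_
    rw [← h] at v₀
    have : 0 < 16 / y ^ 2 := by positivity
    linarith
  have s₀ : stdDev P₀ ≤ 11 / 10 := by
    refine le_of_pow_le_pow_left₀ two_ne_zero (by norm_num) ?_
    rw [v₀]; linarith
  have mem₀ : P₀ ∈ momentClass α η := by
    refine mem_momentClass_of_kurtosis_le hα (by linarith) l₀ s₀pos (by norm_num)
      (int₀ _).1 ?_ hq18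
    rw [m₀, (int₀ fun x => (x - 0) ^ 4).2, show stdDev P₀ ^ 4 = (stdDev P₀ ^ 2) ^ 2 by ring, v₀]
    have e : (1 - 2 * p) * (((-1 - 0) ^ 4 + (1 - 0) ^ 4) / 2) +
        p * (((y - 1 - 0) ^ 4 + (y + 1 - 0) ^ 4) / 2 + ((-y - 1 - 0) ^ 4 + (-y + 1 - 0) ^ 4) / 2) =
        17 + 96 / y ^ 2 := by
      rw [hp]; field_simp; ring
    rw [e]
    have h1 : 96 / y ^ 2 = 6 * (16 / y ^ 2) := by ring
    rw [h1]
    have h2 : 0 < 16 / y ^ 2 := by positivity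
    nlinarith
  have mem₁ : P₁ ∈ momentClass α η := by
    refine mem_momentClass_of_kurtosis_le hα (by linarith) l₁ (by rw [s₁]; norm_num)
      (by norm_num) (integrable_coinMeasure y _) ?_ hq18
    rw [m₁, int₁ fun x => (x - y) ^ 4, s₁]
    ring_nf
    norm_num
  have dev : ∀ P : ProbabilityMeasure ℝ, deviation L P n δ = stdDev P * (L * √y) := by
    intro P
    rw [deviation, one_div, hδ, ← Real.exp_neg, Real.log_exp,
      show (1 + -(1 - y * n)) / (n : ℝ) = y by field_simp; ring]
    ring
  have hLy : L * √y ≤ 9 / 20 * y := by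
    refine le_of_pow_le_pow_left₀ two_ne_zero (by positivity) ?_
    rw [mul_pow, Real.sq_sqrt (by linarith), mul_pow, sq y]
    have : L ^ 2 = y / 5 := by rw [hy]; ring
    rw [this]
    nlinarith
  have hsep : deviation L P₀ n δ + deviation L P₁ n δ < |mean P₁ - mean P₀| := by
    rw [dev, dev, m₀, m₁, sub_zero, s₁, abs_of_pos (by linarith)]
    have : stdDev P₀ * (L * √y) ≤ 11 / 10 * (9 / 20 * y) := by gcongr
    linarith
  have hratio : ∀ A : Set (Fin n → ℝ), MeasurableSet A →
      (sampleLaw P₁ n).real (A ∩ Set.univ) ≤ (p ^ n)⁻¹ * (sampleLaw P₀ n).real A := by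
    intro A hA
    have h := pi_le_pow_smul_pi (n := n) (μ := coinMeasure y) (ν := contaminatedMeasure p y)
      (c := ENNReal.ofReal p) (fun s => ?_) hA
    · rw [Set.inter_univ, inv_mul_eq_div, le_div_iff₀ (by positivity), mul_comm]
      have h' := ENNReal.toReal_mono (measure_ne_top _ _) h
      rw [ENNReal.toReal_mul, ENNReal.toReal_pow, ENNReal.toReal_ofReal hp0.le] at h'
      exact h'
    · simp only [contaminatedMeasure, Measure.add_apply, Measure.smul_apply, smul_eq_mul]
      exact (le_add_right le_rfl).trans (le_add_left le_rfl)
  have hδI : δ ∈ Set.Ico δ 1 := ⟨le_rfl, by linarith⟩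
  have htwo := two_point_le (E := fun x => E (x, ⟨δ, hδI⟩))
    (hE.comp (measurable_id.prodMk measurable_const)) hδ0.le hδ0.le
    (by positivity : 0 ≤ (p ^ n)⁻¹) (hP P₀ mem₀ ⟨δ, hδI⟩) (hP P₁ mem₁ ⟨δ, hδI⟩) (γ := 0)
    (G := Set.univ) (by simp) hratio hsep
  rw [inv_mul_eq_div, le_div_iff₀ (by positivity)] at htwo
  -- `p e ^ y ≥ 3`, while the bound on the error probability needs `(p e ^ y) ^ n < e / (1 - δ)`
  have hpe : 3 ≤ p * Real.exp y := by
    rw [hp, div_mul_eq_mul_div, le_div_iff₀ (by positivity)]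
    exact pow_mul_exp_bound hy10
  have hpn : 3 ≤ p ^ n * Real.exp (y * n) := by
    rw [mul_comm y, Real.exp_nat_mul, ← mul_pow]
    exact hpe.trans (le_self_pow₀ (by linarith) hn.ne')
  have hδe : δ * Real.exp (y * n) = Real.exp 1 := by
    rw [hδ, ← Real.exp_add]; congr 1; ring
  have h1 := mul_le_mul_of_nonneg_right htwo (Real.exp_pos (y * n)).le
  rw [hδe] at h1
  have h2 : 294 / 100 ≤ (1 - δ - 0) * p ^ n * Real.exp (y * n) := by
    rw [mul_assoc]
    nlinarith
  linarith [Real.exp_one_lt_d9]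

end SubGaussianMean

theorem theorem6 (α : ℝ) (hα : 2 < α ∧ α ≤ 3) :
    ∃ C : ℝ, 0 < C ∧
      (∀ η : ℝ, (3 : ℝ) ^ (1 / 3 : ℝ) * (2 : ℝ) ^ (1 / 6 : ℝ) ≤ η →
        ∀ n : ℕ, (3 + Real.log 4) * 124 * (kAlpha C α η : ℝ) ≤ n →
          ∀ B : Blocks n, B.Balanced →
            IsMultipleDelta LStar (momentClass α η) n (deltaMin n (kAlpha C α η))
              (regularEstimator (kAlpha C α η) B)) ∧
      (∀ L : ℝ, √2 ≤ L → ∃ n₀ : ℕ, ∃ c : ℝ, 0 < c ∧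
        ∀ η : ℝ, (3 : ℝ) ^ (1 / 3 : ℝ) * (2 : ℝ) ^ (1 / 6 : ℝ) ≤ η →
          ∀ n : ℕ, n₀ * kAlpha C α η ≤ n →
            ¬ ∃ E : (Fin n → ℝ) → ℝ,
              IsMultipleDelta L (momentClass α η) n
                (Real.exp (1 - c * n / (kAlpha C α η : ℝ))) E) ∧
      (∀ η : ℝ, (3 : ℝ) ^ (1 / 3 : ℝ) * (2 : ℝ) ^ (1 / 6 : ℝ) ≤ η →
        ∀ L : ℝ, √2 ≤ L → ∀ n : ℕ, 0 < n →
          ¬ ∃ E : (Fin n → ℝ) × Set.Ico (Real.exp (1 - 5 * L ^ 2 * n)) 1 → ℝ,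
            IsDeltaDependent L (momentClass α η) n (Real.exp (1 - 5 * L ^ 2 * n)) E) := by
  obtain ⟨C, hC, hreg⟩ := exists_sampleLaw_sum_pos_le hα
  refine ⟨C, hC, fun η hη n hn B hB => ?_, fun L hL => exists_not_isMultipleDelta hα hC hL,
    fun η hη L hL n hn => fun ⟨E, hE⟩ => not_isDeltaDependent hα hη hL hn rfl E hE⟩
  obtain ⟨hη1, -⟩ := eighteen_le_rpow hα hη
  have hη0 : 0 < η := by linarith
  have hk : 0 < kAlpha C α η := Nat.ceil_pos.2 (by positivity)
  exact isMultipleDelta_regularEstimator hk hn (fun P hP => hP.1)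
    (fun P hP F hF u hu => hreg η hη1 P hP n F
      ((Nat.le_ceil _).trans (Nat.cast_le.2 hF)) u hu) hB
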